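/- Let $S$ be a nonempty countable set, $\Xi$ a complete separable metric space, $h:S\times\Xi\to S$ measurable, and $\xi=(\xi_t)_{t\in\mathbb Z}$ random elements of $\Xi$ on a probability space $(\Omega,\mathcal F,\mathbb P)$. The Doeblin graph $\mathcal G$ is the random directed graph with vertex set $\mathbb Z\times S$ and one edge from each $(t,x)$ to $f_+(t,x):=(t+1,h(x,\xi_t))$. For $x\in S$, the bridge graph $\mathbf B(x)$ is the subgraph of $\mathcal G$ with vertex set $V(\mathbf B(x))=\bigcup_{t\in\mathbb Z}\{f_+^n(t,x):n\ge 0\}$. A state path in $\mathcal G$ is a sequence $(X_t)_{t\in\mathbb Z}$ in $S$ such that $(t,X_t)_{t\in\mathbb Z}$ is a directed path in $\mathcal G$. A sequence $(X_t)_{t\in\mathbb Z}$ is bi-recurrent for $x$ if $\{t\in\mathbb Z:X_t=x\}$ is unbounded above and below, and bi-recurrent if this holds for every $x\in S$. A bi-infinite path in $\mathcal G$ is spurious if its state path is not bi-recurrent for any $x\in S$. Assume that $\mathcal G$ has fully independent transitions, i.e. $\xi$ is i.i.d. and for each $t\in\mathbb Z$ the family $(f_+(t,x))_{x\in S}$ is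 independent, and that the transition matrix $P=(p_{x,y})$, $p_{x,y}=\mathbb P(h(x,\xi_0)=y)$, is irreducible, aperiodic and positive recurrent (the return time to $x$ of the path started at $(0,x)$ has finite mean, for every $x\in S$). Then there is a process $(\beta_t)_{t\in\mathbb Z}$ with values in $S$ that is almost surely the unique bi-recurrent state path in $\mathcal G$, and: 1. If $S$ is infinite, $\mathcal G$ is a.s. locally finite, and a.s. $\mathcal G$ contains no spurious bi-infinite path, then almost surely $$\bigcap_{x\in S}V(\mathbf B(x))=\{(t,\beta_t):t\in\mathbb Z\}.$$ 2. If $S$ is finite and has at least two states, then almost surely $$\bigcap_{x\in S}V(\mathbf B(x))\supsetneq\{(t,\beta_t):t\in\mathbb Z\}.$$ -/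

import Mathlib

open MeasureTheory ProbabilityTheory
open scoped ENNReal

namespace Doeblin

section Graph

variable {S Ξ : Type*}

/-- The follow map `f₊(t, x) = (t + 1, h(x, w_t))` on `ℤ × S`, for a pathwise transition
generator `h` and one realization `w` of the driving sequence. -/
def follow (h : S → Ξ → S) (w : ℤ → Ξ) (v : ℤ × S) : ℤ × S :=
  (v.1 + 1, h v.2 (w v.1))

/-- The Doeblin graph: vertex set `ℤ × S`, one edge from each vertex `v` to `f₊ v`. -/
def graph (h : S → Ξ → S) (w : ℤ → Ξ) : Digraph (ℤ × S) where
  Adj u v := follow h w u = v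

/-- Every vertex of the directed graph has finitely many neighbours. -/
def LocallyFinite {V : Type*} (G : Digraph V) : Prop :=
  ∀ v, {u | G.Adj u v ∨ G.Adj v u}.Finite

/-- `X` is a bi-infinite state path in the directed graph `G` on `ℤ × S`, that is,
`(t, X_t)`, `t ∈ ℤ`, is a bi-infinite directed path in `G`. -/
def IsStatePath (G : Digraph (ℤ × S)) (X : ℤ → S) : Prop :=
  ∀ t : ℤ, G.Adj (t, X t) (t + 1, X (t + 1))

/-- The sequence `X` visits `x` at arbitrarily large positive and negative times. -/
def BiRecurrentFor (X : ℤ → S) (x : S) : Prop :=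
  ¬ BddAbove {t : ℤ | X t = x} ∧ ¬ BddBelow {t : ℤ | X t = x}

/-- The sequence `X` is bi-recurrent for every state. -/
def BiRecurrent (X : ℤ → S) : Prop :=
  ∀ x : S, BiRecurrentFor X x

/-- A bi-infinite path is spurious if it is not bi-recurrent for any state. -/
def IsSpurious (G : Digraph (ℤ × S)) (X : ℤ → S) : Prop :=
  IsStatePath G X ∧ ∀ x : S, ¬ BiRecurrentFor X x

/-- Vertex set of the bridge graph `B(x)`: all vertices visited by the paths of the Doeblin graph
started in state `x` at an arbitrary time. -/
def bridgeVertices (h : S → Ξ → S) (w : ℤ → Ξ) (x : S) : Set (ℤ × S) :=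
  ⋃ t : ℤ, {v | ∃ n : ℕ, (follow h w)^[n] (t, x) = v}

/-- The time `σ ∈ {1, 2, …, ∞}` until the path started at time `0` in state `x` returns to `x`. -/
noncomputable def returnTime (h : S → Ξ → S) (w : ℤ → Ξ) (x : S) : ℝ≥0∞ :=
  ⨅ (n : ℕ) (_ : 0 < n ∧ ((follow h w)^[n] (0, x)).2 = x), (n : ℝ≥0∞)

end Graph

section Matrices

variable {S : Type*}

open scoped Classical in
/-- Powers of a nonnegative matrix indexed by a possibly infinite set. -/
noncomputable def matPow (P : S → S → ℝ≥0∞) : ℕ → S → S → ℝ≥0∞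
  | 0 => fun x y => if x = y then 1 else 0
  | n + 1 => fun x y => ∑' z, P x z * matPow P n z y

/-- Every state can be reached from every state with positive probability. -/
def Irreducible (P : S → S → ℝ≥0∞) : Prop :=
  ∀ x y, ∃ n, 0 < matPow P n x y

/-- For every state `x`, the greatest common divisor of `{n ≥ 1 : Pⁿ(x, x) > 0}` is `1`. -/
def Aperiodic (P : S → S → ℝ≥0∞) : Prop :=
  ∀ x, ∀ d : ℕ, (∀ n, 1 ≤ n → 0 < matPow P n x x → d ∣ n) → d = 1

end Matrices

section Random

variable {Ω S Ξ : Type*} [MeasurableSpace Ω]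

/-- The transition matrix `p_{x,y} = ℙ(h(x, ξ₀) = y)`. -/
noncomputable def transition (μ : Measure Ω) (h : S → Ξ → S) (ξ : ℤ → Ω → Ξ) (x y : S) : ℝ≥0∞ :=
  μ {ω | h x (ξ 0 ω) = y}

/-- Every state has finite mean return time. -/
def PositiveRecurrent (μ : Measure Ω) (h : S → Ξ → S) (ξ : ℤ → Ω → Ξ) : Prop :=
  ∀ x, ∫⁻ ω, returnTime h (fun t => ξ t ω) x ∂μ < ∞

/-- Fully independent transitions: the driving sequence is i.i.d. and, for each time `t`,
the family `(f₊(t, x))_{x ∈ S}` is independent. -/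
structure FullyIndependent [MeasurableSpace S] [MeasurableSpace Ξ]
    (μ : Measure Ω) (h : S → Ξ → S) (ξ : ℤ → Ω → Ξ) : Prop where
  indep : iIndepFun ξ μ
  identDistrib : ∀ t, IdentDistrib (ξ t) (ξ 0) μ μ
  vertical : ∀ t : ℤ, iIndepFun (fun (x : S) (ω : Ω) => follow h (fun s => ξ s ω) (t, x)) μ

end Random

end Doeblin

/-! Everything is proved for the canonical i.i.d. sequence with law `iid ℤ ρ`, `ρ` the law of `ξ 0`,
and pulled back along `ω ↦ (ξ t ω)`. Hitting and coalescence: positive recurrence makes the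
`occupation` measure finite, invariant and of full support. Against such a measure a bounded
subharmonic function is harmonic, so a zero of it spreads along all possible transitions. The
probability of avoiding a set is subharmonic and vanishes on the set. Hence every path hits every
state (`avoidProb_singleton`), and any two paths coalesce (`avoidProb_diagonal`): vertical
independence makes two distinct states move independently, and aperiodicity connects all pairs. The
path `β`: by Borel–Cantelli, paths launched from `x` in the far past return to `x` before time `t`,
so they reach only finitely many states at time `t`. Those reached from arbitrarily far back form
the nonempty set `ancestral`. Coalescence shrinks it to one point in the future, and Poincaré
recurrence of the shift transfers this to every time. The resulting path `root` is `β`; any path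
bi-recurrent for some `y` lies in the ancestral set of `y`, whence uniqueness (`ae_root_spec`).
Infinite `S`: a vertex common to all bridge graphs has infinitely many ancestors, so by König's
lemma it lies on a bi-infinite path, which must be `β` (`iInter_bridgeVertices_eq`). Finite `S`:
almost surely, at some time all paths have merged at one state, and then `β` and a second line run
along a walk through all states, the second one step behind. The second line ends in every bridge
graph but off `β` (`ae_exists_mem_iInter_bridgeVertices`). -/

namespace Doeblin

/-! ### Nonnegative matrices, invariant measures and subharmonic functions. -/

section MatrixLemmas

variable {S : Type*}

lemma matPow_succ_right (P : S → S → ℝ≥0∞) (n : ℕ) (x y : S) :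
    matPow P (n + 1) x y = ∑' z, matPow P n x z * P z y := by
  induction n generalizing x with
  | zero =>
    classical
    have h1 : matPow P 1 x y = P x y := by
      simp only [matPow]
      rw [tsum_eq_single y]
      · simp
      · intro z hz; simp [hz]
    rw [h1, tsum_eq_single x]
    · simp [matPow]
    · intro z hz; simp [matPow, hz.symm]
  | succ n ih =>
    have : matPow P (n + 1 + 1) x y = ∑' z, P x z * matPow P (n + 1) z y := rfl
    rw [this]
    simp_rw [ih]
    simp_rw [show ∀ z, matPow P (n + 1) x z = ∑' w, P x w * matPow P n w z from fun _ => rfl]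
    simp_rw [← ENNReal.tsum_mul_left, ← ENNReal.tsum_mul_right]
    rw [ENNReal.tsum_comm]
    simp_rw [mul_assoc]

lemma matPow_succ_pos_iff (P : S → S → ℝ≥0∞) (n : ℕ) (x y : S) :
    0 < matPow P (n + 1) x y ↔ ∃ z, 0 < P x z ∧ 0 < matPow P n z y := by
  simp [matPow, pos_iff_ne_zero, ENNReal.tsum_eq_zero]

lemma matPow_add_pos (P : S → S → ℝ≥0∞) (m n : ℕ) {x y z : S}
    (h1 : 0 < matPow P m x y) (h2 : 0 < matPow P n y z) : 0 < matPow P (m + n) x z := by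
  induction m generalizing x with
  | zero =>
    have : x = y := by
      by_contra hne
      simp [matPow, hne] at h1
    simpa [this] using h2
  | succ m ih =>
    obtain ⟨w, hw, hw'⟩ := (matPow_succ_pos_iff P m x y).1 h1
    rw [Nat.add_right_comm]
    exact (matPow_succ_pos_iff P _ x z).2 ⟨w, hw, ih hw'⟩

/-- In an irreducible aperiodic chain, all sufficiently long transitions are possible. -/
lemma eventually_matPow_pos {P : S → S → ℝ≥0∞} (hirr : Irreducible P) (haper : Aperiodic P)
    (x y : S) : ∀ᶠ n in Filter.atTop, 0 < matPow P n x y := by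
  set A : Set ℕ := {n | 1 ≤ n ∧ 0 < matPow P n x x} with hA
  have hgcd : Nat.setGcd A = 1 :=
    haper x _ fun n hn hp => Nat.setGcd_dvd_of_mem ⟨hn, hp⟩
  -- The additive monoid generated by the return times contains all large multiples of their gcd,
  -- which is `1`.
  obtain ⟨N, hN⟩ := Nat.exists_mem_closure_of_ge A
  obtain ⟨k, hk⟩ := hirr x y
  have hcl : ∀ m ∈ AddSubmonoid.closure A, 0 < matPow P m x x := by
    intro m hm
    induction hm using AddSubmonoid.closure_induction with
    | mem a ha => exact ha.2
    | zero => simp [matPow]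
    | add a b _ _ ha hb => exact matPow_add_pos P a b ha hb
  filter_upwards [Filter.eventually_ge_atTop (N + k)] with n hn
  have : 0 < matPow P ((n - k) + k) x y :=
    matPow_add_pos P _ _ (hcl _ (hN _ (by omega) (by rw [hgcd]; exact one_dvd _))) hk
  rwa [Nat.sub_add_cancel (by omega)] at this

/-- A bounded function which is subharmonic for a kernel with a finite invariant measure of full
support is harmonic. -/
lemma harmonic_of_subharmonic {V : Type*} {K : V → V → ℝ≥0∞} {m g : V → ℝ≥0∞}
    (hm : ∑' v, m v ≠ ∞) (hpos : ∀ v, m v ≠ 0) (hinv : ∀ w, ∑' v, m v * K v w = m w)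
    (hg1 : ∀ v, g v ≤ 1) (hsub : ∀ v, g v ≤ ∑' w, K v w * g w) (v : V) :
    g v = ∑' w, K v w * g w := by
  classical
  -- By invariance `g` and `K g` have the same finite `m`-integral, so a strict inequality at a
  -- point of positive mass is impossible.
  have hsum : ∑' v, m v * ∑' w, K v w * g w = ∑' v, m v * g v := by
    simp_rw [← ENNReal.tsum_mul_left]
    rw [ENNReal.tsum_comm]
    refine tsum_congr fun w => ?_
    rw [← hinv w, ← ENNReal.tsum_mul_right]
    simp_rw [mul_assoc]
  have hfin : ∑' v, m v * g v ≠ ∞ := by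
    refine ne_top_of_le_ne_top hm (ENNReal.tsum_le_tsum fun v => ?_)
    exact mul_le_of_le_one_right' (hg1 v)
  refine le_antisymm (hsub v) ?_
  by_contra hlt
  rw [not_le] at hlt
  have hmv : m v ≠ ∞ := ENNReal.ne_top_of_tsum_ne_top hm v
  have : ∑' v, m v * g v < ∑' v, m v * ∑' w, K v w * g w := by
    refine ENNReal.tsum_lt_tsum hfin (fun v => mul_le_mul_right (hsub v) _) (i := v) ?_
    exact (ENNReal.mul_lt_mul_iff_right (hpos v) hmv).2 hlt
  exact absurd hsum this.ne'

/-- The transition matrix with the transitions into `x` removed. -/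
noncomputable def taboo (P : S → S → ℝ≥0∞) (x : S) : S → S → ℝ≥0∞ :=
  open scoped Classical in fun z y => if y = x then 0 else P z y

/-- The expected number of visits to `y` before the return to `x`. -/
noncomputable def occupation (P : S → S → ℝ≥0∞) (x y : S) : ℝ≥0∞ :=
  ∑' k, matPow (taboo P x) k x y

lemma one_le_occupation_self (P : S → S → ℝ≥0∞) (x : S) : 1 ≤ occupation P x x := by
  refine le_trans ?_ (ENNReal.le_tsum 0)
  simp [matPow]

/-- Away from `x` this is a last-step decomposition, as the taboo does not affect transitions into
`y`. At `x` it follows from conservation of total mass by cancelling the other, finite, terms. -/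
lemma occupation_invariant {P : S → S → ℝ≥0∞} (hP : ∀ x, ∑' y, P x y = 1) (x : S)
    (hfin : ∑' y, occupation P x y ≠ ∞) (y : S) :
    ∑' z, occupation P x z * P z y = occupation P x y := by
  classical
  have hne : ∀ y, y ≠ x → ∑' z, occupation P x z * P z y = occupation P x y := by
    intro y hy
    have h1 : ∀ z, occupation P x z * P z y = ∑' k, matPow (taboo P x) k x z * taboo P x z y := by
      intro z
      rw [occupation, ENNReal.tsum_mul_right]
      simp [taboo, hy]
    simp_rw [h1]
    rw [ENNReal.tsum_comm]
    simp_rw [← matPow_succ_right]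
    rw [occupation, tsum_eq_zero_add' (f := fun k => matPow (taboo P x) k x y) ENNReal.summable]
    simp [matPow, hy.symm]
  by_cases hy : y = x
  · subst hy
    have htot : ∑' w, ∑' z, occupation P y z * P z w = ∑' w, occupation P y w := by
      rw [ENNReal.tsum_comm]
      simp_rw [ENNReal.tsum_mul_left, hP, mul_one]
    rw [ENNReal.tsum_eq_add_tsum_ite y, ENNReal.tsum_eq_add_tsum_ite (f := occupation P y) y] at htot
    have hrest : (∑' w, if w = y then 0 else ∑' z, occupation P y z * P z w) =
        ∑' w, if w = y then 0 else occupation P y w := by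
      refine tsum_congr fun w => ?_
      split_ifs with h
      · rfl
      · exact hne w h
    rw [hrest] at htot
    refine (ENNReal.add_left_inj ?_).1 htot
    refine ne_top_of_le_ne_top hfin (ENNReal.tsum_le_tsum fun w => ?_)
    split_ifs <;> simp
  · exact hne y hy

/-- The support of an invariant measure is closed under possible transitions, and it contains `x`.
-/
lemma occupation_ne_zero {P : S → S → ℝ≥0∞} (hirr : Irreducible P) {x : S}
    (hinv : ∀ y, ∑' z, occupation P x z * P z y = occupation P x y) (y : S) :
    occupation P x y ≠ 0 := by
  obtain ⟨n, hn⟩ := hirr x y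
  have key : ∀ n z, 0 < matPow P n z y → occupation P x z ≠ 0 → occupation P x y ≠ 0 := by
    intro n
    induction n with
    | zero =>
      intro z hz h0
      have : z = y := by
        by_contra hne
        simp [matPow, hne] at hz
      rwa [← this]
    | succ n ih =>
      intro z hz h0
      obtain ⟨w, hw, hw'⟩ := (matPow_succ_pos_iff P n z y).1 hz
      refine ih w hw' ?_
      rw [← hinv w]
      intro h
      rw [ENNReal.tsum_eq_zero] at h
      exact mul_ne_zero h0 hw.ne' (h z)
  exact key n x hn (one_pos.trans_le (one_le_occupation_self P x)).ne'

/-- A bounded subharmonic function for an irreducible chain with an invariant finite measure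
vanishes if it vanishes somewhere. -/
lemma eq_zero_of_subharmonic {P : S → S → ℝ≥0∞} {m g : S → ℝ≥0∞} (hirr : Irreducible P)
    (hm : ∑' v, m v ≠ ∞) (hpos : ∀ v, m v ≠ 0) (hinv : ∀ w, ∑' v, m v * P v w = m w)
    (hg1 : ∀ v, g v ≤ 1) (hsub : ∀ v, g v ≤ ∑' w, P v w * g w) {z : S} (hz : g z = 0) (y : S) :
    g y = 0 := by
  have hh := harmonic_of_subharmonic hm hpos hinv hg1 hsub
  obtain ⟨n, hn⟩ := hirr z y
  induction n generalizing z with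
  | zero =>
    have : z = y := by
      by_contra hne
      simp [matPow, hne] at hn
    rwa [← this]
  | succ n ih =>
    obtain ⟨w, hw, hw'⟩ := (matPow_succ_pos_iff P n z y).1 hn
    refine ih (z := w) ?_ hw'
    have := hh z
    rw [hz, eq_comm, ENNReal.tsum_eq_zero] at this
    simpa [hw.ne'] using this w

/-- The analogue of `eq_zero_of_subharmonic` for two independent copies of an aperiodic chain. -/
lemma eq_zero_of_subharmonic_pair {P : S → S → ℝ≥0∞} {m : S → ℝ≥0∞} {g : S × S → ℝ≥0∞}
    (hirr : Irreducible P) (haper : Aperiodic P)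
    (hm : ∑' v, m v ≠ ∞) (hpos : ∀ v, m v ≠ 0) (hinv : ∀ w, ∑' v, m v * P v w = m w)
    (hg1 : ∀ v, g v ≤ 1)
    (hsub : ∀ v, g v ≤ ∑' w : S × S, P v.1 w.1 * P v.2 w.2 * g w)
    {z : S} (hz : g (z, z) = 0) (y : S × S) : g y = 0 := by
  -- The product measure is invariant for the product kernel.
  have hh := harmonic_of_subharmonic (K := fun v w : S × S => P v.1 w.1 * P v.2 w.2)
    (m := fun v => m v.1 * m v.2) (g := g) ?_ (fun v => mul_ne_zero (hpos _) (hpos _)) ?_ hg1 hsub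
  · have key : ∀ n a b, 0 < matPow P n a y.1 → 0 < matPow P n b y.2 → g (a, b) = 0 → g y = 0 := by
      intro n
      induction n with
      | zero =>
        intro a b ha hb h0
        have h1 : a = y.1 := by
          by_contra hne
          simp [matPow, hne] at ha
        have h2 : b = y.2 := by
          by_contra hne
          simp [matPow, hne] at hb
        rwa [h1, h2] at h0
      | succ n ih =>
        intro a b ha hb h0
        obtain ⟨w, hw, hw'⟩ := (matPow_succ_pos_iff P n a y.1).1 ha
        obtain ⟨v, hv, hv'⟩ := (matPow_succ_pos_iff P n b y.2).1 hb
        refine ih w v hw' hv' ?_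
        have := hh (a, b)
        rw [h0, eq_comm, ENNReal.tsum_eq_zero] at this
        simpa [hw.ne', hv.ne'] using this (w, v)
    -- Both coordinates must be reached in the same number of steps; this is where aperiodicity
    -- enters.
    obtain ⟨n, h1, h2⟩ := ((eventually_matPow_pos hirr haper z y.1).and
      (eventually_matPow_pos hirr haper z y.2)).exists
    exact key n z z h1 h2 hz
  · rw [ENNReal.tsum_prod' (f := fun v : S × S => m v.1 * m v.2)]
    simp_rw [ENNReal.tsum_mul_left, ENNReal.tsum_mul_right]
    exact ENNReal.mul_ne_top hm hm
  · intro w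
    rw [ENNReal.tsum_prod' (f := fun v : S × S => m v.1 * m v.2 * (P v.1 w.1 * P v.2 w.2))]
    calc ∑' a, ∑' b, m a * m b * (P a w.1 * P b w.2)
        = ∑' a, ∑' b, (m a * P a w.1) * (m b * P b w.2) := by
          refine tsum_congr fun a => tsum_congr fun b => by ring
      _ = m w.1 * m w.2 := by
          simp_rw [ENNReal.tsum_mul_left, ENNReal.tsum_mul_right, hinv]

end MatrixLemmas

/-! ### One-sided trajectories driven by i.i.d. noise. -/

section Trajectories

variable {V Ξ : Type*}

/-- The trajectory started in `v` and driven by the sequence `u`. -/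
def traj (h : V → Ξ → V) (u : ℕ → Ξ) (v : V) : ℕ → V
  | 0 => v
  | n + 1 => h (traj h u v n) (u n)

lemma traj_add (h : V → Ξ → V) (u : ℕ → Ξ) (v : V) (m n : ℕ) :
    traj h u v (m + n) = traj h (fun k => u (m + k)) (traj h u v m) n := by
  induction n with
  | zero => rfl
  | succ n ih => rw [← add_assoc, traj, ih, traj]

lemma traj_succ_left (h : V → Ξ → V) (u : ℕ → Ξ) (v : V) (n : ℕ) :
    traj h u v (n + 1) = traj h (fun k => u (1 + k)) (h v (u 0)) n := by
  rw [add_comm, traj_add]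
  rfl

lemma traj_congr (h : V → Ξ → V) {u u' : ℕ → Ξ} (v : V) {n : ℕ} (hu : ∀ i < n, u i = u' i) :
    traj h u v n = traj h u' v n := by
  induction n with
  | zero => rfl
  | succ n ih => rw [traj, traj, ih fun i hi => hu i (by omega), hu n (by omega)]

/-- The sequence which follows `p.1` before time `m` and then `p.2`. -/
def glue (m : ℕ) (p : (ℕ → Ξ) × (ℕ → Ξ)) (i : ℕ) : Ξ :=
  if i < m then p.1 i else p.2 (i - m)

lemma glue_add (m : ℕ) (p : (ℕ → Ξ) × (ℕ → Ξ)) : (fun i => glue m p (m + i)) = p.2 := by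
  funext i
  simp [glue]

variable [MeasurableSpace Ξ]

lemma measurable_traj [Countable V] [MeasurableSpace V] [DiscreteMeasurableSpace V]
    {h : V → Ξ → V} (hh : ∀ v, Measurable (h v)) (v : V) (n : ℕ) :
    Measurable fun u : ℕ → Ξ => traj h u v n := by
  have hh' : Measurable fun p : V × Ξ => h p.1 p.2 := measurable_from_prod_countable_right hh
  induction n with
  | zero => exact measurable_const
  | succ n ih => exact hh'.comp (ih.prodMk (measurable_pi_apply n))

/-- The law of an i.i.d. family with marginal `ρ`. -/
noncomputable def iid (ι : Type*) (ρ : Measure Ξ) : Measure (ι → Ξ) :=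
  Measure.infinitePi fun _ : ι => ρ

variable (ρ : Measure Ξ)

/-- The probability that the trajectory started in `v` avoids `D` forever. -/
noncomputable def avoidProb (h : V → Ξ → V) (D : Set V) (v : V) : ℝ≥0∞ :=
  iid ℕ ρ {u | ∀ n, traj h u v n ∉ D}

lemma avoidProb_of_mem (h : V → Ξ → V) {D : Set V} {v : V} (hv : v ∈ D) :
    avoidProb ρ h D v = 0 := by
  have : {u : ℕ → Ξ | ∀ n, traj h u v n ∉ D} = ∅ :=
    Set.eq_empty_of_forall_notMem fun u hu => hu 0 hv
  rw [avoidProb, this, measure_empty]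

lemma ae_exists_traj_mem {h : V → Ξ → V} {D : Set V} {v : V} (h0 : avoidProb ρ h D v = 0) :
    ∀ᵐ u ∂(iid ℕ ρ), ∃ n, traj h u v n ∈ D := by
  rw [ae_iff]
  simpa [avoidProb] using h0

variable [IsProbabilityMeasure ρ]

instance isProbabilityMeasure_iid (ι : Type*) : IsProbabilityMeasure (iid ι ρ) := by
  unfold iid; infer_instance

lemma measurePreserving_iid {ι κ : Type*} {f : κ → ι} (hf : Function.Injective f) :
    MeasurePreserving (fun (w : ι → Ξ) (i : κ) => w (f i)) (iid ι ρ) (iid κ ρ) :=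
  ⟨by fun_prop, Measure.map_infinitePi_infinitePi_of_inj hf⟩

lemma measurable_glue (m : ℕ) : Measurable (glue m : (ℕ → Ξ) × (ℕ → Ξ) → ℕ → Ξ) := by
  refine measurable_pi_lambda _ fun i => ?_
  unfold glue
  split_ifs <;> fun_prop

/-- Replacing the future of an i.i.d. sequence by an independent copy does not change its law; this
encodes independence of past and future. -/
lemma measurePreserving_glue (m : ℕ) :
    MeasurePreserving (glue m) ((iid ℕ ρ).prod (iid ℕ ρ)) (iid ℕ ρ) := by
  refine ⟨measurable_glue m, Measure.eq_infinitePi _ fun s t ht => ?_⟩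
  have hset : glue m ⁻¹' (Set.pi s t) =
      (Set.pi (s.filter (· < m) : Finset ℕ) t) ×ˢ
        (Set.pi ((s.filter (m ≤ ·)).image (· - m) : Finset ℕ) fun i => t (m + i)) := by
    ext p
    simp only [Set.mem_preimage, Set.mem_pi, Finset.mem_coe, Set.mem_prod, Finset.mem_filter,
      Finset.mem_image, glue]
    constructor
    · intro hp
      refine ⟨fun i hi => by simpa [hi.2] using hp i hi.1, ?_⟩
      rintro _ ⟨i, hi, rfl⟩
      have := hp i hi.1
      rw [if_neg (by omega)] at this
      rwa [Nat.add_sub_cancel' hi.2]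
    · rintro ⟨h1, h2⟩ i hi
      split_ifs with him
      · exact h1 i ⟨hi, him⟩
      · have := h2 (i - m) ⟨i, ⟨hi, by omega⟩, rfl⟩
        rwa [Nat.add_sub_cancel' (by omega)] at this
  rw [Measure.map_apply (measurable_glue m) (MeasurableSet.pi s.countable_toSet fun i _ => ht i),
    hset, Measure.prod_prod, iid, Measure.infinitePi_pi _ fun i _ => ht i,
    Measure.infinitePi_pi _ fun i _ => ht _, Finset.prod_image]
  · rw [← Finset.prod_filter_mul_prod_filter_not s (· < m)]
    congr 1
    refine Finset.prod_congr (by ext; simp) fun i hi => ?_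
    rw [Finset.mem_filter] at hi
    rw [Nat.add_sub_cancel' (not_lt.1 hi.2)]
  · intro a ha b hb hab
    simp only [Finset.coe_filter, Set.mem_ofPred_eq] at ha hb
    simp only at hab
    omega

/-- Events before time `m` are independent of events from time `m` on. -/
lemma iid_inter_shift (m : ℕ) {E B : Set (ℕ → Ξ)} (hE : MeasurableSet E) (hB : MeasurableSet B)
    (hdep : ∀ u u' : ℕ → Ξ, (∀ i < m, u i = u' i) → u ∈ E → u' ∈ E) :
    iid ℕ ρ {u | u ∈ E ∧ (fun i => u (m + i)) ∈ B} = iid ℕ ρ E * iid ℕ ρ B := by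
  have hmeas : MeasurableSet {u : ℕ → Ξ | u ∈ E ∧ (fun i => u (m + i)) ∈ B} :=
    hE.inter ((measurable_pi_lambda _ fun i => measurable_pi_apply _ :
      Measurable fun (u : ℕ → Ξ) (i : ℕ) => u (m + i)) hB)
  rw [← (measurePreserving_glue ρ m).measure_preimage hmeas.nullMeasurableSet,
    ← Measure.prod_prod]
  congr 1
  ext p
  simp only [Set.mem_preimage, Set.mem_ofPred_eq, glue_add, Set.mem_prod]
  have : glue m p ∈ E ↔ p.1 ∈ E :=
    ⟨hdep _ _ fun i hi => by simp [glue, hi], hdep _ _ fun i hi => by simp [glue, hi]⟩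
  rw [this]

lemma iid_zero_shift {A : Set Ξ} {B : Set (ℕ → Ξ)} (hA : MeasurableSet A)
    (hB : MeasurableSet B) :
    iid ℕ ρ {u | u 0 ∈ A ∧ (fun i => u (1 + i)) ∈ B} = ρ A * iid ℕ ρ B := by
  have h0 : MeasurePreserving (fun u : ℕ → Ξ => u 0) (iid ℕ ρ) ρ :=
    measurePreserving_eval_infinitePi (fun _ : ℕ => ρ) 0
  rw [← h0.measure_preimage hA.nullMeasurableSet]
  exact iid_inter_shift ρ 1 (h0.measurable hA) hB fun u u' h hu => by
    change u' 0 ∈ A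
    rw [← h 0 one_pos]
    exact hu

variable [Countable V] [MeasurableSpace V] [DiscreteMeasurableSpace V]

/-- First step decomposition. -/
lemma iid_first_step {h : V → Ξ → V} (hh : ∀ v, Measurable (h v)) (v : V)
    {B : V → Set (ℕ → Ξ)} (hB : ∀ v, MeasurableSet (B v)) :
    iid ℕ ρ {u | (fun i => u (1 + i)) ∈ B (h v (u 0))} =
      ∑' w, ρ {e | h v e = w} * iid ℕ ρ (B w) := by
  have hm : ∀ w, MeasurableSet {e | h v e = w} := fun w => hh v (measurableSet_singleton w)
  have hset : {u : ℕ → Ξ | (fun i => u (1 + i)) ∈ B (h v (u 0))} =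
      ⋃ w, {u : ℕ → Ξ | u 0 ∈ {e | h v e = w} ∧ (fun i => u (1 + i)) ∈ B w} := by
    ext u
    simp
  rw [hset, measure_iUnion]
  · exact tsum_congr fun w => iid_zero_shift ρ (hm w) (hB w)
  · intro a b hab
    refine Set.disjoint_left.2 fun u ha hb => hab ?_
    exact ha.1.symm.trans hb.1
  · intro w
    exact (measurable_pi_apply 0 (hm w)).inter ((measurable_pi_lambda _ fun i =>
      measurable_pi_apply _ : Measurable fun (u : ℕ → Ξ) (i : ℕ) => u (1 + i)) (hB w))

/-- First-step analysis. Together with the value `0` on `D` it makes the avoidance probability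
subharmonic. -/
lemma avoidProb_of_notMem {h : V → Ξ → V} (hh : ∀ v, Measurable (h v)) {D : Set V} {v : V}
    (hv : v ∉ D) : avoidProb ρ h D v = ∑' w, ρ {e | h v e = w} * avoidProb ρ h D w := by
  unfold avoidProb
  rw [← iid_first_step ρ hh v (B := fun w => {u | ∀ n, traj h u w n ∉ D})]
  · congr 1
    ext u
    simp only [Set.mem_ofPred_eq, ← traj_succ_left]
    exact ⟨fun hu n => hu _, fun hu n => by cases n with
      | zero => exact hv
      | succ n => exact hu n⟩
  · intro w
    simp only [Set.ofPred_forall]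
    exact MeasurableSet.iInter fun n => (measurable_traj hh w n) (MeasurableSet.of_discrete (s := Dᶜ))

/-- Links the matrix side to the tail of the return time: for `y = x`, the right side is the
probability that the return takes more than `k` steps. -/
lemma matPow_taboo_eq {h : V → Ξ → V} (hh : ∀ v, Measurable (h v)) (x : V) (k : ℕ) (y : V) :
    ∑' z, matPow (taboo (fun v w => ρ {e | h v e = w}) x) k y z =
      iid ℕ ρ {u | ∀ n < k, traj h u y (n + 1) ≠ x} := by
  classical
  induction k generalizing y with
  | zero =>
    simp [matPow]
  | succ k ih =>
    have hstep := iid_first_step ρ hh y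
      (B := fun w => {u | w ≠ x ∧ ∀ n < k, traj h u w (n + 1) ≠ x}) fun w => by
        have hk : MeasurableSet {u : ℕ → Ξ | ∀ n < k, traj h u w (n + 1) ≠ x} := by
          simp only [Set.ofPred_forall]
          exact MeasurableSet.iInter fun n => MeasurableSet.iInter fun _ =>
            (measurable_traj hh w (n + 1)) (MeasurableSet.of_discrete (s := {x}ᶜ))
        exact (MeasurableSet.const (w ≠ x)).inter hk
    have hset : {u : ℕ → Ξ | ∀ n < k + 1, traj h u y (n + 1) ≠ x} =
        {u | (fun i => u (1 + i)) ∈ (fun w => {u : ℕ → Ξ | w ≠ x ∧ ∀ n < k, traj h u w (n + 1) ≠ x})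
          (h y (u 0))} := by
      ext u
      simp only [Set.mem_ofPred_eq, ← traj_succ_left]
      constructor
      · exact fun hu => ⟨hu 0 (by omega), fun n hn => hu (n + 1) (by omega)⟩
      · rintro ⟨h1, h2⟩ n hn
        cases n with
        | zero => exact h1
        | succ n => exact h2 n (by omega)
    rw [hset, hstep]
    simp only [matPow]
    rw [ENNReal.tsum_comm]
    refine tsum_congr fun w => ?_
    rw [ENNReal.tsum_mul_left, ih w]
    by_cases hw : w = x
    · simp [taboo, hw]
    · simp [taboo, hw]

end Trajectories

/-! ### Almost sure hitting of states and coalescence of pairs. -/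

section Pair

variable {S Ξ : Type*}

/-- The simultaneous evolution of two states. -/
def pairMap (h : S → Ξ → S) (v : S × S) (e : Ξ) : S × S :=
  (h v.1 e, h v.2 e)

lemma traj_pairMap (h : S → Ξ → S) (u : ℕ → Ξ) (v : S × S) (n : ℕ) :
    traj (pairMap h) u v n = (traj h u v.1 n, traj h u v.2 n) := by
  induction n with
  | zero => rfl
  | succ n ih => simp [traj, ih, pairMap]

/-- The transition matrix of the chain driven by `h` and noise with law `ρ`. -/
noncomputable def transMatrix [MeasurableSpace Ξ] (ρ : Measure Ξ) (h : S → Ξ → S) (x y : S) :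
    ℝ≥0∞ :=
  ρ {e | h x e = y}

variable [MeasurableSpace Ξ] (ρ : Measure Ξ) [IsProbabilityMeasure ρ]
  [Countable S] [MeasurableSpace S] [DiscreteMeasurableSpace S]
  {h : S → Ξ → S}

lemma tsum_transMatrix (hh : ∀ x, Measurable (h x)) (x : S) :
    ∑' y, transMatrix ρ h x y = 1 := by
  unfold transMatrix
  rw [← measure_iUnion]
  · rw [← measure_univ (μ := ρ)]
    congr 1
    ext e
    simp
  · intro a b hab
    exact Set.disjoint_left.2 fun e ha hb => hab (ha.symm.trans hb)
  · exact fun y => hh x (measurableSet_singleton y)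

lemma tsum_occupation (hh : ∀ x, Measurable (h x)) (x : S) :
    ∑' y, occupation (transMatrix ρ h) x y =
      ∑' k, iid ℕ ρ {u | ∀ n < k, traj h u x (n + 1) ≠ x} := by
  unfold occupation
  rw [ENNReal.tsum_comm]
  exact tsum_congr fun k => matPow_taboo_eq ρ hh x k x

/-- Every state is hit from every state, almost surely. -/
lemma avoidProb_singleton (hh : ∀ x, Measurable (h x)) (hirr : Irreducible (transMatrix ρ h))
    (hfin : ∀ x, ∑' y, occupation (transMatrix ρ h) x y ≠ ∞) (z y : S) :
    avoidProb ρ h {z} y = 0 := by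
  have hinv := occupation_invariant (tsum_transMatrix ρ hh) z (hfin z)
  refine eq_zero_of_subharmonic (g := avoidProb ρ h {z}) hirr (hfin z)
    (occupation_ne_zero hirr hinv) hinv
    (fun v => prob_le_one) (fun v => ?_) (avoidProb_of_mem ρ h (Set.mem_singleton z)) y
  by_cases hv : v = z
  · rw [avoidProb_of_mem ρ h (D := {z}) hv]
    exact zero_le
  · exact (avoidProb_of_notMem ρ hh (D := {z}) hv).le

/-- Any two trajectories coalesce almost surely. -/
lemma avoidProb_diagonal (hh : ∀ x, Measurable (h x)) (hvert : iIndepFun h ρ)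
    (hirr : Irreducible (transMatrix ρ h)) (haper : Aperiodic (transMatrix ρ h))
    (hfin : ∀ x, ∑' y, occupation (transMatrix ρ h) x y ≠ ∞) (v : S × S) :
    avoidProb ρ (pairMap h) (Set.diagonal S) v = 0 := by
  have z := v.1
  have hinv := occupation_invariant (tsum_transMatrix ρ hh) z (hfin z)
  refine eq_zero_of_subharmonic_pair (g := avoidProb ρ (pairMap h) (Set.diagonal S)) hirr haper
    (hfin z) (occupation_ne_zero hirr hinv) hinv
    (fun v => prob_le_one)
    (fun v => ?_) (avoidProb_of_mem ρ _ (Set.mem_diagonal z)) v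
  -- The pair chain has the product kernel only off the diagonal; on the diagonal subharmonicity is
  -- trivial because the avoidance probability is `0` there.
  by_cases hv : v ∈ Set.diagonal S
  · rw [avoidProb_of_mem ρ _ hv]
    exact zero_le
  · rw [avoidProb_of_notMem ρ (h := pairMap h) (fun v => (hh v.1).prodMk (hh v.2)) hv]
    refine (tsum_congr fun w => ?_).le
    congr 1
    rw [transMatrix, transMatrix]
    have := (hvert.indepFun (i := v.1) (j := v.2) hv).measure_inter_preimage_eq_mul
      {w.1} {w.2} (measurableSet_singleton _) (measurableSet_singleton _)
    refine Eq.trans ?_ this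
    congr 1
    ext e
    simp [pairMap, Prod.ext_iff]

end Pair

/-! ### Paths of the Doeblin graph over two-sided time, and the time shift. -/

section Walk

variable {S Ξ : Type*}

/-- The state after `n` steps of the path of the Doeblin graph started in `(s, y)`. -/
def walk (h : S → Ξ → S) (w : ℤ → Ξ) (s : ℤ) (y : S) (n : ℕ) : S :=
  traj h (fun k => w (s + k)) y n

variable (h : S → Ξ → S) (w : ℤ → Ξ)

@[simp] lemma walk_zero (s : ℤ) (y : S) : walk h w s y 0 = y := rfl

lemma walk_succ (s : ℤ) (y : S) (n : ℕ) :
    walk h w s y (n + 1) = h (walk h w s y n) (w (s + n)) := rfl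

lemma walk_add (s : ℤ) (y : S) (m n : ℕ) :
    walk h w s y (m + n) = walk h w (s + m) (walk h w s y m) n := by
  unfold walk
  rw [traj_add]
  congr
  funext k
  push_cast
  rw [add_assoc]

lemma follow_iterate (s : ℤ) (y : S) (n : ℕ) :
    (follow h w)^[n] (s, y) = (s + n, walk h w s y n) := by
  induction n with
  | zero => simp
  | succ n ih =>
    rw [Function.iterate_succ_apply', ih, follow, walk_succ]
    simp [add_assoc]

/-- The shift by one unit of time. -/
def shift (w : ℤ → Ξ) : ℤ → Ξ := fun t => w (t + 1)

lemma shift_iterate (n : ℕ) : shift^[n] w = fun t => w (t + n) := by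
  induction n with
  | zero => simp
  | succ n ih =>
    rw [Function.iterate_succ_apply', ih]
    funext t
    simp only [shift]
    push_cast
    congr 1
    ring

lemma walk_shift_iterate (m : ℕ) (s : ℤ) (y : S) (n : ℕ) :
    walk h (shift^[m] w) s y n = walk h w (s + m) y n := by
  unfold walk
  rw [shift_iterate]
  congr 1
  funext k
  ring_nf

lemma measurable_walk [MeasurableSpace Ξ] [Countable S] [MeasurableSpace S]
    [DiscreteMeasurableSpace S] {h : S → Ξ → S} (hh : ∀ x, Measurable (h x)) (s : ℤ) (y : S) (n : ℕ) :
    Measurable fun w : ℤ → Ξ => walk h w s y n :=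
  (measurable_traj hh y n).comp (measurable_pi_lambda _ fun _ => measurable_pi_apply _)

end Walk

/-! ### Almost sure return, hitting and coalescence of these paths. -/

section WalkAE

variable {S Ξ : Type*} [MeasurableSpace Ξ] (ρ : Measure Ξ) [IsProbabilityMeasure ρ]

lemma measurePreserving_shift : MeasurePreserving shift (iid ℤ ρ) (iid ℤ ρ) :=
  measurePreserving_iid ρ (add_left_injective 1)

lemma measurePreserving_future (s : ℤ) :
    MeasurePreserving (fun (w : ℤ → Ξ) (k : ℕ) => w (s + k)) (iid ℤ ρ) (iid ℕ ρ) :=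
  measurePreserving_iid ρ fun a b hab => by simpa using hab

variable [Countable S] [MeasurableSpace S] [DiscreteMeasurableSpace S] {h : S → Ξ → S}

/-- Borel–Cantelli over the launch times `t - k`: the failure probabilities are the tails of the
return time, whose sum is the total occupation mass. -/
lemma ae_walk_returns (hh : ∀ x, Measurable (h x))
    (hfin : ∀ x, ∑' y, occupation (transMatrix ρ h) x y ≠ ∞) :
    ∀ᵐ w ∂(iid ℤ ρ), ∀ (x : S) (t : ℤ),
      ∀ᶠ k : ℕ in Filter.atTop, ∃ n < k, walk h w (t - k) x (n + 1) = x := by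
  refine ae_all_iff.2 fun x => ae_all_iff.2 fun t => ?_
  have hmeas : ∀ k, MeasurableSet {u : ℕ → Ξ | ∀ n < k, traj h u x (n + 1) ≠ x} := by
    intro k
    simp only [Set.ofPred_forall]
    exact MeasurableSet.iInter fun n => MeasurableSet.iInter fun _ =>
      (measurable_traj hh x (n + 1)) (MeasurableSet.of_discrete (s := {x}ᶜ))
  have hsum : ∑' k : ℕ, iid ℤ ρ {w | ∀ n < k, walk h w (t - k) x (n + 1) ≠ x} ≠ ∞ := by
    refine ne_of_eq_of_ne (tsum_congr fun k => ?_) (tsum_occupation ρ hh x ▸ hfin x)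
    exact (measurePreserving_future ρ (t - k)).measure_preimage (hmeas k).nullMeasurableSet
  filter_upwards [ae_eventually_notMem hsum] with w hw
  filter_upwards [hw] with k hk
  simpa using hk

lemma ae_walk_hits (hh : ∀ x, Measurable (h x)) (hirr : Irreducible (transMatrix ρ h))
    (hfin : ∀ x, ∑' y, occupation (transMatrix ρ h) x y ≠ ∞) :
    ∀ᵐ w ∂(iid ℤ ρ), ∀ (s : ℤ) (y z : S), ∃ n, walk h w s y n = z := by
  refine ae_all_iff.2 fun s => ae_all_iff.2 fun y => ae_all_iff.2 fun z => ?_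
  exact (measurePreserving_future ρ s).quasiMeasurePreserving.ae
    (ae_exists_traj_mem ρ (avoidProb_singleton ρ hh hirr hfin z y))

lemma ae_traj_coalesces (hh : ∀ x, Measurable (h x)) (hvert : iIndepFun h ρ)
    (hirr : Irreducible (transMatrix ρ h)) (haper : Aperiodic (transMatrix ρ h))
    (hfin : ∀ x, ∑' y, occupation (transMatrix ρ h) x y ≠ ∞) :
    ∀ᵐ u ∂(iid ℕ ρ), ∀ y z : S, ∃ n, traj h u y n = traj h u z n := by
  refine ae_all_iff.2 fun y => ae_all_iff.2 fun z => ?_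
  filter_upwards [ae_exists_traj_mem ρ
    (avoidProb_diagonal ρ hh hvert hirr haper hfin (y, z))] with u ⟨n, hn⟩
  rw [traj_pairMap] at hn
  exact ⟨n, hn⟩

lemma ae_walk_coalesces (hh : ∀ x, Measurable (h x)) (hvert : iIndepFun h ρ)
    (hirr : Irreducible (transMatrix ρ h)) (haper : Aperiodic (transMatrix ρ h))
    (hfin : ∀ x, ∑' y, occupation (transMatrix ρ h) x y ≠ ∞) :
    ∀ᵐ w ∂(iid ℤ ρ), ∀ (s : ℤ) (y z : S), ∃ n, walk h w s y n = walk h w s z n :=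
  ae_all_iff.2 fun s => (measurePreserving_future ρ s).quasiMeasurePreserving.ae
    (ae_traj_coalesces ρ hh hvert hirr haper hfin)

end WalkAE

/-! ### States reached from arbitrarily far in the past. -/

section Ancestral

variable {S Ξ : Type*}

/-- The states reached at time `t` by paths started in `x` at arbitrarily early times. -/
def ancestral (h : S → Ξ → S) (x : S) (w : ℤ → Ξ) (t : ℤ) : Set S :=
  {y | ∃ᶠ k : ℕ in Filter.atTop, walk h w (t - k) x k = y}

lemma exists_frequently_eq {p : ℕ → Prop} (hp : ∃ᶠ k in Filter.atTop, p k) {f : ℕ → S}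
    {F : Set S} (hF : F.Finite) (hf : ∀ k, f k ∈ F) :
    ∃ y, ∃ᶠ k in Filter.atTop, p k ∧ f k = y := by
  by_contra! hcon
  have : ∀ᶠ k in Filter.atTop, ∀ y ∈ F, ¬ (p k ∧ f k = y) :=
    (Filter.eventually_all_finite hF).2 fun y _ => (hcon y).mono fun k hk hk' => hk hk'.1 hk'.2
  obtain ⟨k, hk, hk'⟩ := (hp.and_eventually this).exists
  exact hk' _ (hf k) ⟨hk, rfl⟩

variable {h : S → Ξ → S} {x : S} {w : ℤ → Ξ}

/-- A path launched far back revisits `x` no later than `t`, so a later launch gives the same state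
at `t`; repeating this leaves only the launches with `k < K`. -/
lemma finite_walk_of_returns {t : ℤ}
    (hret : ∀ᶠ k : ℕ in Filter.atTop, ∃ n < k, walk h w (t - k) x (n + 1) = x) :
    {y | ∃ k : ℕ, walk h w (t - k) x k = y}.Finite := by
  obtain ⟨K, hK⟩ := Filter.eventually_atTop.1 hret
  have key : ∀ k : ℕ, ∃ j < K, walk h w (t - k) x k = walk h w (t - j) x j := by
    intro k
    induction k using Nat.strong_induction_on with
    | _ k ih =>
      rcases lt_or_ge k K with hk | hk
      · exact ⟨k, hk, rfl⟩
      · obtain ⟨n, hn, hx⟩ := hK k hk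
        obtain ⟨j, hj, hj'⟩ := ih (k - (n + 1)) (by omega)
        refine ⟨j, hj, ?_⟩
        rw [← hj']
        have h1 : walk h w (t - k) x ((n + 1) + (k - (n + 1))) =
            walk h w (t - k + ((n + 1 : ℕ) : ℤ)) x (k - (n + 1)) := by
          rw [walk_add, hx]
        rw [Nat.add_sub_cancel' (by omega)] at h1
        rw [h1]
        congr 1
        push_cast [Nat.cast_sub (show n + 1 ≤ k by omega)]
        ring
  refine ((Set.finite_lt_nat K).image fun j : ℕ => walk h w (t - j) x j).subset ?_
  rintro y ⟨k, rfl⟩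
  obtain ⟨j, hj, hj'⟩ := key k
  exact ⟨j, hj, hj'.symm⟩

lemma ancestral_subset (t : ℤ) :
    ancestral h x w t ⊆ {y | ∃ k : ℕ, walk h w (t - k) x k = y} :=
  fun _ hy => hy.exists

lemma ancestral_nonempty {t : ℤ}
    (hfin : {y | ∃ k : ℕ, walk h w (t - k) x k = y}.Finite) : (ancestral h x w t).Nonempty := by
  obtain ⟨y, hy⟩ := exists_frequently_eq (p := fun _ : ℕ => True)
    (Filter.Frequently.of_forall fun _ => trivial) hfin
    (f := fun k : ℕ => walk h w (t - k) x k) fun k => ⟨k, rfl⟩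
  exact ⟨y, hy.mono fun k hk => hk.2⟩

lemma walk_sub_succ (t : ℤ) (k : ℕ) :
    walk h w (t + 1 - (k + 1 : ℕ)) x (k + 1) = h (walk h w (t - k) x k) (w t) := by
  rw [walk_succ]
  push_cast
  rw [add_sub_add_right_eq_sub, sub_add_cancel]

lemma ancestral_step {t : ℤ} {y : S} (hy : y ∈ ancestral h x w t) :
    h y (w t) ∈ ancestral h x w (t + 1) := by
  refine Filter.frequently_atTop.2 fun a => ?_
  obtain ⟨k, hk, hk'⟩ := Filter.frequently_atTop.1 hy a
  exact ⟨k + 1, by omega, by rw [walk_sub_succ, hk']⟩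

lemma ancestral_walk {t : ℤ} {y : S} (hy : y ∈ ancestral h x w t) (n : ℕ) :
    walk h w t y n ∈ ancestral h x w (t + n) := by
  induction n with
  | zero => simpa
  | succ n ih =>
    have := ancestral_step ih
    rw [walk_succ]
    convert this using 2
    push_cast
    ring

lemma exists_ancestral_pred {t : ℤ} (hfin : {y | ∃ k : ℕ, walk h w (t - k) x k = y}.Finite)
    {y : S} (hy : y ∈ ancestral h x w (t + 1)) : ∃ z ∈ ancestral h x w t, h z (w t) = y := by
  have hy' : ∃ᶠ k : ℕ in Filter.atTop, h (walk h w (t - k) x k) (w t) = y := by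
    refine Filter.frequently_atTop.2 fun a => ?_
    obtain ⟨k, hk, hk'⟩ := Filter.frequently_atTop.1 hy (a + 1)
    obtain ⟨k, rfl⟩ := Nat.exists_eq_add_of_le' (show 1 ≤ k by omega)
    exact ⟨k, by omega, (walk_sub_succ t k).symm.trans hk'⟩
  obtain ⟨z, hz⟩ := exists_frequently_eq hy' hfin
    (f := fun k : ℕ => walk h w (t - k) x k) fun k => ⟨k, rfl⟩
  refine ⟨z, hz.mono fun k hk => hk.2, ?_⟩
  obtain ⟨k, hk, rfl⟩ := hz.exists
  exact hk

lemma exists_ancestral_walk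
    (hfin : ∀ t : ℤ, {y | ∃ k : ℕ, walk h w (t - k) x k = y}.Finite) (t : ℤ) (n : ℕ)
    {y : S} (hy : y ∈ ancestral h x w (t + n)) : ∃ z ∈ ancestral h x w t, walk h w t z n = y := by
  induction n generalizing y with
  | zero => exact ⟨y, by simpa using hy, rfl⟩
  | succ n ih =>
    push_cast at hy
    rw [← add_assoc] at hy
    obtain ⟨z, hz, hzy⟩ := exists_ancestral_pred (hfin _) hy
    obtain ⟨z', hz', rfl⟩ := ih hz
    exact ⟨z', hz', hzy⟩

lemma ancestral_shift_iterate (x : S) (w : ℤ → Ξ) (m : ℕ) (t : ℤ) :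
    ancestral h x (shift^[m] w) t = ancestral h x w (t + m) := by
  unfold ancestral
  simp_rw [walk_shift_iterate, sub_add_eq_add_sub]

lemma walk_eq_of_walk_eq {s : ℤ} {y z : S} {m n : ℕ} (hmn : m ≤ n)
    (heq : walk h w s y m = walk h w s z m) : walk h w s y n = walk h w s z n := by
  obtain ⟨k, rfl⟩ := Nat.exists_eq_add_of_le hmn
  rw [walk_add, walk_add, heq]

/-- The ancestral set at `t + n` is contained in the image of the finite one at `t`, whose finitely
many paths eventually merge. -/
lemma eventually_ancestral_subsingleton
    (hfin : ∀ t : ℤ, {y | ∃ k : ℕ, walk h w (t - k) x k = y}.Finite)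
    (hcoal : ∀ (s : ℤ) (y z : S), ∃ n, walk h w s y n = walk h w s z n) (t : ℤ) :
    ∀ᶠ n : ℕ in Filter.atTop, (ancestral h x w (t + n)).Subsingleton := by
  have hA : (ancestral h x w t).Finite := (hfin t).subset (ancestral_subset t)
  have : ∀ᶠ n : ℕ in Filter.atTop, ∀ y ∈ ancestral h x w t, ∀ z ∈ ancestral h x w t,
      walk h w t y n = walk h w t z n := by
    refine (Filter.eventually_all_finite hA).2 fun y _ =>
      (Filter.eventually_all_finite hA).2 fun z _ => ?_
    obtain ⟨m, hm⟩ := hcoal t y z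
    filter_upwards [Filter.eventually_ge_atTop m] with n hn using walk_eq_of_walk_eq hn hm
  filter_upwards [this] with n hn a ha b hb
  obtain ⟨y, hy, rfl⟩ := exists_ancestral_walk hfin t n ha
  obtain ⟨z, hz, rfl⟩ := exists_ancestral_walk hfin t n hb
  exact hn y hy z hz

end Ancestral

/-! ### The bi-recurrent path: construction, measurability and uniqueness. -/

section Root

variable {S Ξ : Type*}

open scoped Classical in
/-- The element of `A` if `A` is a singleton, and `x` otherwise. -/
noncomputable def soleElement (x : S) (A : Set S) : S :=
  if hA : ∃ y, A = {y} then hA.choose else x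

lemma soleElement_singleton (x y : S) : soleElement x {y} = y := by
  have hex : ∃ z, ({y} : Set S) = {z} := ⟨y, rfl⟩
  rw [soleElement, dif_pos hex]
  exact (Set.singleton_injective hex.choose_spec).symm

/-- The state at time `t` of the bi-infinite path in the bridge graph of `x`. -/
noncomputable def root (h : S → Ξ → S) (x : S) (w : ℤ → Ξ) (t : ℤ) : S :=
  soleElement x (ancestral h x w t)

lemma root_eq {h : S → Ξ → S} {x : S} {w : ℤ → Ξ} {t : ℤ} {y : S}
    (hy : ancestral h x w t = {y}) : root h x w t = y := by
  rw [root, hy, soleElement_singleton]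

lemma root_shift_iterate (h : S → Ξ → S) (x : S) (w : ℤ → Ξ) (m : ℕ) (t : ℤ) :
    root h x (shift^[m] w) t = root h x w (t + m) := by
  rw [root, root, ancestral_shift_iterate]

lemma root_mem {h : S → Ξ → S} {x : S} {w : ℤ → Ξ} {t : ℤ}
    (hne : (ancestral h x w t).Nonempty) (hsub : (ancestral h x w t).Subsingleton) :
    root h x w t ∈ ancestral h x w t := by
  obtain ⟨y, hy⟩ := (Set.exists_eq_singleton_iff_nonempty_subsingleton).2 ⟨hne, hsub⟩
  rw [root_eq hy, hy]
  rfl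

section Measurability

variable [MeasurableSpace Ξ] [Countable S] [MeasurableSpace S] [DiscreteMeasurableSpace S]
  {h : S → Ξ → S}

lemma measurableSet_mem_ancestral (hh : ∀ x, Measurable (h x)) (x : S) (t : ℤ) (y : S) :
    MeasurableSet {w : ℤ → Ξ | y ∈ ancestral h x w t} := by
  have : {w : ℤ → Ξ | y ∈ ancestral h x w t} =
      ⋂ a : ℕ, ⋃ k : ℕ, ⋃ _ : k ≥ a, {w | walk h w (t - k) x k = y} := by
    ext w
    simp [ancestral, Filter.frequently_atTop]
  rw [this]
  exact MeasurableSet.iInter fun a => MeasurableSet.iUnion fun k => MeasurableSet.iUnion fun _ =>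
    measurable_walk hh (t - k) x k (measurableSet_singleton y)

lemma measurableSet_ancestral_eq (hh : ∀ x, Measurable (h x)) (x : S) (t : ℤ) (y : S) :
    MeasurableSet {w : ℤ → Ξ | ancestral h x w t = {y}} := by
  have : {w : ℤ → Ξ | ancestral h x w t = {y}} =
      {w | y ∈ ancestral h x w t} ∩ ⋂ z, ⋂ _ : z ≠ y, {w | z ∈ ancestral h x w t}ᶜ := by
    ext w
    simp only [Set.mem_ofPred_eq, Set.mem_inter_iff, Set.mem_iInter, Set.mem_compl_iff]
    rw [Set.eq_singleton_iff_unique_mem]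
    exact and_congr_right fun _ => forall_congr' fun z => by tauto
  rw [this]
  exact (measurableSet_mem_ancestral hh x t y).inter (MeasurableSet.iInter fun z =>
    MeasurableSet.iInter fun _ => (measurableSet_mem_ancestral hh x t z).compl)

lemma measurable_root (hh : ∀ x, Measurable (h x)) (x : S) (t : ℤ) :
    Measurable fun w : ℤ → Ξ => root h x w t := by
  refine measurable_to_countable' fun y => ?_
  -- The second piece comes from the default value `x` of `soleElement`.
  have : (fun w : ℤ → Ξ => root h x w t) ⁻¹' {y} =
      {w | ancestral h x w t = {y}} ∪ ((⋃ z, {w | ancestral h x w t = {z}})ᶜ ∩ {_w | x = y}) := by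
    ext w
    simp only [Set.mem_preimage, Set.mem_singleton_iff, Set.mem_union, Set.mem_ofPred_eq,
      Set.mem_inter_iff, Set.mem_compl_iff, Set.mem_iUnion]
    by_cases hex : ∃ z, ancestral h x w t = {z}
    · obtain ⟨z, hz⟩ := hex
      rw [root_eq hz, hz, Set.singleton_eq_singleton_iff]
      simp
    · rw [root, soleElement, dif_neg hex]
      have : ancestral h x w t ≠ {y} := fun hy => hex ⟨y, hy⟩
      simp [hex, this]
  rw [this]
  exact (measurableSet_ancestral_eq hh x t y).union
    ((MeasurableSet.iUnion fun z => measurableSet_ancestral_eq hh x t z).compl.inter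
      (MeasurableSet.const _))

variable (ρ : Measure Ξ) [IsProbabilityMeasure ρ]

/-- A stationary event whose translates eventually fail almost surely is null. -/
lemma ae_notMem_of_eventually_notMem {E : Set (ℤ → Ξ)} (hE : MeasurableSet E)
    (hev : ∀ᵐ w ∂(iid ℤ ρ), ∀ᶠ n in Filter.atTop, shift^[n] w ∉ E) :
    ∀ᵐ w ∂(iid ℤ ρ), w ∉ E := by
  -- Poincaré recurrence: almost every point of `E` returns to `E` infinitely often under the shift.
  filter_upwards [hev, (measurePreserving_shift ρ).conservative.ae_mem_imp_frequently_image_mem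
    hE.nullMeasurableSet] with w h1 h2 hw
  exact h2 hw h1

lemma ae_ancestral_subsingleton (hh : ∀ x, Measurable (h x)) (hvert : iIndepFun h ρ)
    (hirr : Irreducible (transMatrix ρ h)) (haper : Aperiodic (transMatrix ρ h))
    (hfin : ∀ x, ∑' y, occupation (transMatrix ρ h) x y ≠ ∞) :
    ∀ᵐ w ∂(iid ℤ ρ), ∀ x t, (ancestral h x w t).Subsingleton := by
  refine ae_all_iff.2 fun x => ae_all_iff.2 fun t => ?_
  have hE : MeasurableSet {w : ℤ → Ξ | ∃ y z, y ≠ z ∧ y ∈ ancestral h x w t ∧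
      z ∈ ancestral h x w t} := by
    simp only [Set.ofPred_exists]
    exact MeasurableSet.iUnion fun y => MeasurableSet.iUnion fun z =>
      (MeasurableSet.const (y ≠ z)).inter ((measurableSet_mem_ancestral hh x t y).inter
        (measurableSet_mem_ancestral hh x t z))
  have := ae_notMem_of_eventually_notMem ρ hE ?_
  · filter_upwards [this] with w hw y hy z hz
    by_contra hne
    exact hw ⟨y, z, hne, hy, hz⟩
  · filter_upwards [ae_walk_returns ρ hh hfin, ae_walk_coalesces ρ hh hvert hirr haper hfin]
      with w h1 h2
    filter_upwards [eventually_ancestral_subsingleton (fun t => finite_walk_of_returns (h1 x t))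
      h2 t] with n hn
    rintro ⟨y, z, hne, hy, hz⟩
    rw [ancestral_shift_iterate] at hy hz
    exact hne (hn hy hz)

lemma ae_root_mem_ancestral (hh : ∀ x, Measurable (h x)) (hvert : iIndepFun h ρ)
    (hirr : Irreducible (transMatrix ρ h)) (haper : Aperiodic (transMatrix ρ h))
    (hfin : ∀ x, ∑' y, occupation (transMatrix ρ h) x y ≠ ∞) :
    ∀ᵐ w ∂(iid ℤ ρ), ∀ x t, root h x w t ∈ ancestral h x w t := by
  filter_upwards [ae_walk_returns ρ hh hfin, ae_ancestral_subsingleton ρ hh hvert hirr haper hfin]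
    with w h1 h2 x t
  exact root_mem (ancestral_nonempty (finite_walk_of_returns (h1 x t))) (h2 x t)

lemma ae_walk_root (hh : ∀ x, Measurable (h x)) (hvert : iIndepFun h ρ)
    (hirr : Irreducible (transMatrix ρ h)) (haper : Aperiodic (transMatrix ρ h))
    (hfin : ∀ x, ∑' y, occupation (transMatrix ρ h) x y ≠ ∞) :
    ∀ᵐ w ∂(iid ℤ ρ), ∀ x t (n : ℕ), walk h w t (root h x w t) n = root h x w (t + n) := by
  filter_upwards [ae_root_mem_ancestral ρ hh hvert hirr haper hfin,
    ae_ancestral_subsingleton ρ hh hvert hirr haper hfin] with w h1 h2 x t n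
  exact h2 x _ (ancestral_walk (h1 x t) n) (h1 x _)

lemma ae_root_past (hh : ∀ x, Measurable (h x)) (hvert : iIndepFun h ρ)
    (hirr : Irreducible (transMatrix ρ h)) (haper : Aperiodic (transMatrix ρ h))
    (hfin : ∀ x, ∑' y, occupation (transMatrix ρ h) x y ≠ ∞) (x : S) :
    ∀ᵐ w ∂(iid ℤ ρ), ∀ (t : ℤ) (z : S), ∃ n : ℕ, root h x w (t - 1 - n) = z := by
  refine ae_all_iff.2 fun t => ae_all_iff.2 fun z => ?_
  -- Shifted by `m`, this event says that `z` is not visited before `t + m`. A visit after `t`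
  -- refutes it for all large `m`, so future visits yield past ones.
  have hE : MeasurableSet {w : ℤ → Ξ | ∀ n : ℕ, root h x w (t - 1 - n) ≠ z} := by
    simp only [Set.ofPred_forall]
    exact MeasurableSet.iInter fun n =>
      measurable_root hh x _ (MeasurableSet.of_discrete (s := {z}ᶜ))
  have := ae_notMem_of_eventually_notMem ρ hE ?_
  · filter_upwards [this] with w hw
    simpa using hw
  · filter_upwards [ae_walk_root ρ hh hvert hirr haper hfin, ae_walk_hits ρ hh hirr hfin]
      with w h1 h2
    obtain ⟨n, hn⟩ := h2 t (root h x w t) z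
    rw [h1] at hn
    filter_upwards [Filter.eventually_ge_atTop (n + 1)] with m hm hmem
    refine hmem (m - (n + 1)) ?_
    rw [root_shift_iterate, ← hn]
    congr 1
    push_cast [Nat.cast_sub hm]
    ring

end Measurability

lemma isStatePath_graph_iff {h : S → Ξ → S} {w : ℤ → Ξ} {X : ℤ → S} :
    IsStatePath (graph h w) X ↔ ∀ t, h (X t) (w t) = X (t + 1) := by
  simp [IsStatePath, graph, follow]

lemma IsStatePath.walk_eq {h : S → Ξ → S} {w : ℤ → Ξ} {X : ℤ → S}
    (hX : IsStatePath (graph h w) X) (t : ℤ) (n : ℕ) : walk h w t (X t) n = X (t + n) := by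
  rw [isStatePath_graph_iff] at hX
  induction n with
  | zero => simp
  | succ n ih =>
    rw [walk_succ, ih, hX]
    congr 1
    push_cast
    ring

lemma IsStatePath.mem_ancestral {h : S → Ξ → S} {w : ℤ → Ξ} {X : ℤ → S}
    (hX : IsStatePath (graph h w) X) {x : S} (hx : BiRecurrentFor X x) (t : ℤ) :
    X t ∈ ancestral h x w t := by
  refine Filter.frequently_atTop.2 fun a => ?_
  obtain ⟨s, hs, hst⟩ := not_bddBelow_iff.1 hx.2 (t - a)
  refine ⟨(t - s).toNat, by omega, ?_⟩
  have hcast : ((t - s).toNat : ℤ) = t - s := Int.toNat_of_nonneg (by omega)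
  have := hX.walk_eq s (t - s).toNat
  rw [hs, hcast] at this
  rw [hcast]
  simpa using this

/-- Almost surely, `root` is a state path which is bi-recurrent for every state, and it is the only
state path which is bi-recurrent for some state. -/
theorem ae_root_spec [MeasurableSpace Ξ] [Countable S] [MeasurableSpace S]
    [DiscreteMeasurableSpace S] {h : S → Ξ → S} (ρ : Measure Ξ) [IsProbabilityMeasure ρ]
    (hh : ∀ x, Measurable (h x)) (hvert : iIndepFun h ρ)
    (hirr : Irreducible (transMatrix ρ h)) (haper : Aperiodic (transMatrix ρ h))
    (hfin : ∀ x, ∑' y, occupation (transMatrix ρ h) x y ≠ ∞) (x : S) :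
    ∀ᵐ w ∂(iid ℤ ρ), IsStatePath (graph h w) (root h x w) ∧ BiRecurrent (root h x w) ∧
      ∀ X, IsStatePath (graph h w) X → (∃ y, BiRecurrentFor X y) → X = root h x w := by
  filter_upwards [ae_walk_root ρ hh hvert hirr haper hfin, ae_walk_hits ρ hh hirr hfin,
    ae_root_past ρ hh hvert hirr haper hfin x,
    ae_ancestral_subsingleton ρ hh hvert hirr haper hfin] with w h1 h2 h3 h4
  have hpath : IsStatePath (graph h w) (root h x w) :=
    isStatePath_graph_iff.2 fun t => by simpa [walk_succ] using h1 x t 1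
  have hbi : BiRecurrent (root h x w) := by
    refine fun z => ⟨not_bddAbove_iff.2 fun t => ?_, not_bddBelow_iff.2 fun t => ?_⟩
    · obtain ⟨n, hn⟩ := h2 (t + 1) (root h x w (t + 1)) z
      rw [h1] at hn
      exact ⟨_, hn, by omega⟩
    · obtain ⟨n, hn⟩ := h3 t z
      exact ⟨_, hn, by omega⟩
  refine ⟨hpath, hbi, fun X hX ⟨y, hy⟩ => funext fun t => ?_⟩
  -- Both paths are compared in the ancestral set of `y`, not of `x`; this also shows that `root`
  -- does not depend on `x`.
  exact h4 y t (hX.mem_ancestral hy t) (hpath.mem_ancestral (hbi y) t)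

end Root

/-! ### Intersection of the bridge graphs over an infinite state space. -/

section Bridge

/-- König's lemma: among finitely many preimages of a vertex with infinitely many ancestors, one
again has infinitely many. -/
lemma exists_backward_orbit {V : Type*} {F : V → V} (hfin : ∀ v, {u | F u = v}.Finite) {v : V}
    (hinf : {u | ∃ n : ℕ, F^[n] u = v}.Infinite) :
    ∃ p : ℕ → V, p 0 = v ∧ ∀ n, F (p (n + 1)) = p n := by
  have hstep : ∀ v : {v // {u | ∃ n : ℕ, F^[n] u = v}.Infinite},
      ∃ v' : {v // {u | ∃ n : ℕ, F^[n] u = v}.Infinite}, F v' = v := by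
    rintro ⟨v, hv⟩
    by_contra! hcon
    have hsub : {u | ∃ n : ℕ, F^[n] u = v} ⊆
        {v} ∪ ⋃ v' ∈ {u | F u = v}, {u | ∃ n : ℕ, F^[n] u = v'} := by
      rintro u ⟨n, hn⟩
      cases n with
      | zero => exact Or.inl hn
      | succ n =>
        rw [Function.iterate_succ_apply'] at hn
        exact Or.inr (Set.mem_biUnion (x := F^[n] u) hn ⟨n, rfl⟩)
    refine hv (Set.Finite.subset ((Set.finite_singleton v).union ((hfin v).biUnion ?_)) hsub)
    intro v' hv'
    by_contra hinf
    exact hcon ⟨v', hinf⟩ hv'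
  choose f hf using hstep
  refine ⟨fun n => (f^[n] ⟨v, hinf⟩ : _), rfl, fun n => ?_⟩
  simp only [Function.iterate_succ_apply', hf]

variable {S Ξ : Type*} {h : S → Ξ → S} {w : ℤ → Ξ}

lemma mem_bridgeVertices {x : S} {v : ℤ × S} :
    v ∈ bridgeVertices h w x ↔ ∃ (s : ℤ) (n : ℕ), (follow h w)^[n] (s, x) = v := by
  simp [bridgeVertices]

/-- A vertex with infinitely many ancestors in a locally finite Doeblin graph lies on a
bi-infinite path. -/
lemma exists_isStatePath_of_infinite (hloc : LocallyFinite (graph h w)) {v : ℤ × S}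
    (hinf : {u | ∃ n : ℕ, (follow h w)^[n] u = v}.Infinite) :
    ∃ X, IsStatePath (graph h w) X ∧ X v.1 = v.2 := by
  obtain ⟨p, hp0, hp⟩ := exists_backward_orbit (F := follow h w)
    (fun v => (hloc v).subset fun u hu => Or.inl hu) hinf
  -- Truncation in `toNat` makes this the backward orbit before time `v.1` and the forward orbit of
  -- `v` afterwards.
  set Y : ℤ → ℤ × S := fun s => (follow h w)^[(s - v.1).toNat] (p (v.1 - s).toNat) with hY
  have hstep : ∀ s, follow h w (Y s) = Y (s + 1) := by
    intro s
    rcases lt_or_ge s v.1 with hs | hs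
    · obtain ⟨n, hn⟩ : ∃ n : ℕ, v.1 - s = n + 1 := ⟨(v.1 - s - 1).toNat, by omega⟩
      have h1 : (s - v.1).toNat = 0 := by omega
      have h2 : (s + 1 - v.1).toNat = 0 := by omega
      have h3 : (v.1 - s).toNat = n + 1 := by omega
      have h4 : (v.1 - (s + 1)).toNat = n := by omega
      simp only [hY, h1, h2, h3, h4, Function.iterate_zero, id, hp]
    · have h1 : (s + 1 - v.1).toNat = (s - v.1).toNat + 1 := by omega
      have h2 : (v.1 - s).toNat = 0 := by omega
      have h3 : (v.1 - (s + 1)).toNat = 0 := by omega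
      simp only [hY, h1, h2, h3, Function.iterate_succ_apply']
  have hYv : Y v.1 = v := by simp [hY, hp0]
  have hfirst : ∀ s, (Y s).1 = s := by
    have hs : ∀ s, (Y (s + 1)).1 = (Y s).1 + 1 := fun s => by rw [← hstep]; rfl
    intro s
    induction s using Int.inductionOn' (b := v.1) with
    | zero => rw [hYv]
    | succ k _ ih => rw [hs, ih]
    | pred k _ ih =>
      have := hs (k - 1)
      rw [sub_add_cancel, ih] at this
      omega
  refine ⟨fun s => (Y s).2, isStatePath_graph_iff.2 fun s => ?_, by simp only [hYv]⟩
  have := congrArg Prod.snd (hstep s)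
  simpa [follow, hfirst s] using this

/-- Each state `x` supplies an ancestor with state `x`, and these are distinct. -/
lemma infinite_ancestors [Infinite S] {v : ℤ × S} (hv : v ∈ ⋂ x, bridgeVertices h w x) :
    {u | ∃ n : ℕ, (follow h w)^[n] u = v}.Infinite := by
  simp only [Set.mem_iInter, mem_bridgeVertices] at hv
  choose s hs using hv
  exact Set.infinite_of_injective_forall_mem (f := fun x => (s x, x))
    (fun a b hab => (Prod.ext_iff.1 hab).2) hs

lemma subset_iInter_bridgeVertices {X : ℤ → S} (hX : IsStatePath (graph h w) X)
    (hbi : BiRecurrent X) : {v : ℤ × S | ∃ t, v = (t, X t)} ⊆ ⋂ x, bridgeVertices h w x := by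
  rintro _ ⟨t, rfl⟩
  refine Set.mem_iInter.2 fun x => mem_bridgeVertices.2 ?_
  obtain ⟨s, hs, hst⟩ := not_bddBelow_iff.1 (hbi x).2 t
  have hcast : ((t - s).toNat : ℤ) = t - s := Int.toNat_of_nonneg (by omega)
  refine ⟨s, (t - s).toNat, ?_⟩
  rw [follow_iterate, ← hs, hX.walk_eq, hcast, add_sub_cancel]

/-- Without spurious paths in an infinite state space, the bridge graphs have only the
bi-recurrent path in common. -/
lemma iInter_bridgeVertices_eq [Infinite S] (hloc : LocallyFinite (graph h w))
    (hspur : ¬ ∃ X, IsSpurious (graph h w) X) {X : ℤ → S} (hX : IsStatePath (graph h w) X)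
    (hbi : BiRecurrent X)
    (huniq : ∀ Y, IsStatePath (graph h w) Y → (∃ y, BiRecurrentFor Y y) → Y = X) :
    ⋂ x, bridgeVertices h w x = {v : ℤ × S | ∃ t, v = (t, X t)} := by
  refine Set.Subset.antisymm (fun v hv => ?_) (subset_iInter_bridgeVertices hX hbi)
  obtain ⟨Y, hY, hYv⟩ := exists_isStatePath_of_infinite hloc (infinite_ancestors hv)
  have hrec : ∃ y, BiRecurrentFor Y y := by
    by_contra hcon
    exact hspur ⟨Y, hY, not_exists.1 hcon⟩
  refine ⟨v.1, ?_⟩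
  rw [← huniq Y hY hrec, hYv]

end Bridge

/-! ### An extra common vertex over a finite state space. -/

section FiniteStates

/-- All of `A` is met before the last vertex: the final edge is kept in reserve for the line running
one step ahead. -/
lemma exists_covering_walk {S : Type*} {R : S → S → Prop}
    (hconn : ∀ a b, Relation.ReflTransGen R a b) (hsucc : ∀ a, ∃ b, R a b) (A : Finset S) :
    ∀ a, ∃ (N : ℕ) (c : ℕ → S), c 0 = a ∧ (∀ i < N + 1, R (c i) (c (i + 1))) ∧
      ∀ x ∈ A, ∃ i < N + 1, c i = x := by
  classical
  induction A using Finset.induction_on with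
  | empty =>
    intro a
    obtain ⟨b, hb⟩ := hsucc a
    refine ⟨0, fun n => if n = 0 then a else b, by simp, fun i hi => ?_, by simp⟩
    obtain rfl : i = 0 := by omega
    simpa using hb
  | insert x A _ ih =>
    intro a
    induction hconn a x using Relation.ReflTransGen.head_induction_on with
    | refl =>
      obtain ⟨N, c, h0, hc, hA⟩ := ih x
      refine ⟨N, c, h0, hc, fun y hy => ?_⟩
      rcases Finset.mem_insert.1 hy with rfl | hy
      · exact ⟨0, by omega, h0⟩
      · exact hA y hy
    | @head a b hab _ ih' =>
      obtain ⟨N, c, h0, hc, hA⟩ := ih'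
      refine ⟨N + 1, fun n => Nat.casesOn n a c, rfl, fun i hi => ?_, fun y hy => ?_⟩
      · cases i with
        | zero => simpa [h0] using hab
        | succ i => exact hc i (by omega)
      · obtain ⟨i, hi, hiy⟩ := hA y hy
        exact ⟨i + 1, by omega, hiy⟩

/-- Loops are discarded so that consecutive states of the walk differ: two lines one step apart then
stay distinct and move independently. -/
lemma reflTransGen_of_matPow_pos {S : Type*} {P : S → S → ℝ≥0∞} {n : ℕ} {a b : S} (hn : 0 < matPow P n a b) :
    Relation.ReflTransGen (fun a b => a ≠ b ∧ 0 < P a b) a b := by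
  induction n generalizing a with
  | zero =>
    have : a = b := by
      by_contra hne
      simp [matPow, hne] at hn
    rw [this]
  | succ n ih =>
    obtain ⟨z, hz, hz'⟩ := (matPow_succ_pos_iff P n a b).1 hn
    by_cases haz : a = z
    · rw [haz]
      exact ih hz'
    · exact Relation.ReflTransGen.head ⟨haz, hz⟩ (ih hz')

variable {S Ξ : Type*} [MeasurableSpace Ξ] (ρ : Measure Ξ) [IsProbabilityMeasure ρ]

/-- In an i.i.d. sequence, a finite-block event of positive probability occurs almost surely. -/
lemma ae_exists_block {L : ℕ} {E : Set (ℕ → Ξ)} (hE : MeasurableSet E)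
    (hdep : ∀ u u' : ℕ → Ξ, (∀ i < L, u i = u' i) → u ∈ E → u' ∈ E) (hpos : iid ℕ ρ E ≠ 0) :
    ∀ᵐ u ∂(iid ℕ ρ), ∃ s : ℕ, (fun i => u (s + i)) ∈ E := by
  have hshift : ∀ s : ℕ, Measurable fun (u : ℕ → Ξ) (i : ℕ) => u (s + i) := fun s =>
    measurable_pi_lambda _ fun i => measurable_pi_apply _
  set B : Set (ℕ → Ξ) := {u | ∀ s : ℕ, (fun i => u (s + i)) ∉ E} with hB
  have hBm : MeasurableSet B := by
    simp only [hB, Set.ofPred_forall]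
    exact MeasurableSet.iInter fun s => (hshift s hE).compl
  -- If the block never occurs, it fails at time `0` and never occurs from `L` on; these are
  -- independent, and the first factor is below `1`.
  have hle : iid ℕ ρ B ≤ iid ℕ ρ Eᶜ * iid ℕ ρ B := by
    rw [← iid_inter_shift ρ L hE.compl hBm fun u u' huu' hu hu' =>
      hu (hdep u' u (fun i hi => (huu' i hi).symm) hu')]
    refine measure_mono fun u hu => ⟨?_, fun s => ?_⟩
    · simpa using hu 0
    · simpa only [← add_assoc] using hu (L + s)
  have hlt : iid ℕ ρ Eᶜ < 1 := by
    rw [prob_compl_eq_one_sub hE]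
    exact ENNReal.sub_lt_self ENNReal.one_ne_top one_ne_zero hpos
  have hzero : iid ℕ ρ B = 0 := by
    by_contra hne
    have := ENNReal.mul_lt_mul_left hne (measure_ne_top _ _) hlt
    rw [one_mul] at this
    exact absurd hle this.not_ge
  rw [ae_iff]
  convert hzero using 2
  simp [hB]

variable [MeasurableSpace S] [DiscreteMeasurableSpace S] {h : S → Ξ → S}

/-- Two distinct lines follow the walk `c`, one of them a step ahead, with positive probability. -/
lemma iid_two_lines_ne_zero [Countable S] (hh : ∀ x, Measurable (h x)) (hvert : iIndepFun h ρ)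
    {M : ℕ} {c : ℕ → S} (hc : ∀ i < M + 1, c i ≠ c (i + 1) ∧ 0 < transMatrix ρ h (c i) (c (i + 1))) :
    iid ℕ ρ {u | ∀ i < M, h (c i) (u i) = c (i + 1) ∧ h (c (i + 1)) (u i) = c (i + 2)} ≠ 0 := by
  have hset : {u : ℕ → Ξ | ∀ i < M, h (c i) (u i) = c (i + 1) ∧ h (c (i + 1)) (u i) = c (i + 2)} =
      Set.pi (Finset.range M : Finset ℕ)
        fun i => h (c i) ⁻¹' {c (i + 1)} ∩ h (c (i + 1)) ⁻¹' {c (i + 2)} := by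
    ext u
    simp
  rw [hset, iid, Measure.infinitePi_pi _ fun i _ =>
    (hh _ (measurableSet_singleton _)).inter (hh _ (measurableSet_singleton _))]
  refine Finset.prod_ne_zero_iff.2 fun i hi => ?_
  rw [Finset.mem_range] at hi
  rw [(hvert.indepFun (hc i (by omega)).1).measure_inter_preimage_eq_mul _ _
    (measurableSet_singleton _) (measurableSet_singleton _)]
  exact mul_ne_zero (hc i (by omega)).2.ne' (hc (i + 1) (by omega)).2.ne'

lemma exists_iid_const_ne_zero [Finite S] [Nonempty S] (hh : ∀ x, Measurable (h x))
    (hvert : iIndepFun h ρ)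
    (hirr : Irreducible (transMatrix ρ h)) (haper : Aperiodic (transMatrix ρ h))
    (hfin : ∀ x, ∑' y, occupation (transMatrix ρ h) x y ≠ ∞) :
    ∃ (m : ℕ) (z : S), iid ℕ ρ {u | ∀ y, traj h u y m = z} ≠ 0 := by
  by_contra! hcon
  have hall : ∀ᵐ u ∂(iid ℕ ρ), ∀ (m : ℕ) (z : S), ¬ ∀ y, traj h u y m = z := by
    refine ae_all_iff.2 fun m => ae_all_iff.2 fun z => ?_
    rw [ae_iff]
    simpa using hcon m z
  obtain ⟨u, hu, hu'⟩ := (hall.and (ae_traj_coalesces ρ hh hvert hirr haper hfin)).exists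
  choose n hn using hu'
  have x : S := Classical.arbitrary S
  -- By finiteness, some time `m` exceeds the coalescence times of the path from `x` with all
  -- others.
  obtain ⟨m, hm⟩ := (Set.finite_range (n x)).bddAbove
  refine hu m (traj h u x m) fun y => ?_
  obtain ⟨k, rfl⟩ := Nat.exists_eq_add_of_le (hm ⟨y, rfl⟩)
  rw [traj_add, traj_add, hn]

/-- For a finite state space, the bridge graphs share a vertex outside of the bi-recurrent path. -/
lemma ae_exists_mem_iInter_bridgeVertices [Finite S] [Nontrivial S]
    (hh : ∀ x, Measurable (h x)) (hvert : iIndepFun h ρ)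
    (hirr : Irreducible (transMatrix ρ h)) (haper : Aperiodic (transMatrix ρ h))
    (hfin : ∀ x, ∑' y, occupation (transMatrix ρ h) x y ≠ ∞) :
    ∀ᵐ w ∂(iid ℤ ρ), ∀ X, IsStatePath (graph h w) X →
      ∃ v ∈ ⋂ x, bridgeVertices h w x, X v.1 ≠ v.2 := by
  classical
  have := Fintype.ofFinite S
  obtain ⟨m, z, hmz⟩ := exists_iid_const_ne_zero ρ hh hvert hirr haper hfin
  set R : S → S → Prop := fun a b => a ≠ b ∧ 0 < transMatrix ρ h a b with hR
  have hconn : ∀ a b, Relation.ReflTransGen R a b := fun a b =>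
    reflTransGen_of_matPow_pos (hirr a b).choose_spec
  have hsucc : ∀ a, ∃ b, R a b := fun a => by
    obtain ⟨b, hb⟩ := exists_ne a
    rcases (hconn a b).cases_head with rfl | ⟨c, hc, _⟩
    · exact absurd rfl hb
    · exact ⟨c, hc⟩
  obtain ⟨c₀, hc₀⟩ : ∃ c₀, R c₀ z := by
    obtain ⟨b, hb⟩ := exists_ne z
    rcases (hconn b z).cases_tail with rfl | ⟨c, _, hc⟩
    · exact absurd rfl hb
    · exact ⟨c, hc⟩
  -- The covering walk from `z` is preceded by `c₀`: after merging at `z = c 1`, the path `X` is one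
  -- step ahead of the line started in `c 0`.
  obtain ⟨M, c, hc1, hc, hcov⟩ : ∃ (M : ℕ) (c : ℕ → S), c 1 = z ∧
      (∀ i < M + 1, R (c i) (c (i + 1))) ∧ ∀ x, ∃ i < M + 1, c i = x := by
    obtain ⟨N, c, h0, hc, hA⟩ := exists_covering_walk hconn hsucc Finset.univ z
    refine ⟨N + 1, fun n => Nat.casesOn n c₀ c, h0, fun i hi => ?_, fun x => ?_⟩
    · cases i with
      | zero => simpa [h0] using hc₀
      | succ i => exact hc i (by omega)
    · obtain ⟨i, hi, hix⟩ := hA x (Finset.mem_univ x)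
      exact ⟨i + 1, by omega, hix⟩
  -- `C` merges all states at `z` in `m` steps; `B` then moves the two lines along `c` for `M`
  -- steps.
  set C : Set (ℕ → Ξ) := {u | ∀ y, traj h u y m = z}
  set B : Set (ℕ → Ξ) :=
    {u | ∀ i < M, h (c i) (u i) = c (i + 1) ∧ h (c (i + 1)) (u i) = c (i + 2)}
  have hCm : MeasurableSet C := by
    have : C = ⋂ y, {u | traj h u y m = z} := by ext; simp [C]
    rw [this]
    exact MeasurableSet.iInter fun y => measurable_traj hh y m (measurableSet_singleton z)
  have hBm : MeasurableSet B := by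
    have : B = ⋂ i, ⋂ _ : i < M, {u | h (c i) (u i) = c (i + 1)} ∩
        {u | h (c (i + 1)) (u i) = c (i + 2)} := by ext; simp [B]
    rw [this]
    exact MeasurableSet.iInter fun i => MeasurableSet.iInter fun _ =>
      (((hh _).comp (measurable_pi_apply i)) (measurableSet_singleton _)).inter
        (((hh _).comp (measurable_pi_apply i)) (measurableSet_singleton _))
  have hpos : iid ℕ ρ {u | u ∈ C ∧ (fun i => u (m + i)) ∈ B} ≠ 0 := by
    rw [iid_inter_shift ρ m hCm hBm fun u u' huu' hu y => by
      rw [← hu y]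
      exact (traj_congr h y huu').symm]
    exact mul_ne_zero hmz (iid_two_lines_ne_zero ρ hh hvert hc)
  have hblock := ae_exists_block ρ (L := m + M) (hCm.inter ((measurable_pi_lambda _ fun i =>
    measurable_pi_apply _ : Measurable fun (u : ℕ → Ξ) (i : ℕ) => u (m + i)) hBm)) (by
      rintro u u' huu' ⟨h1, h2⟩
      refine ⟨fun y => ?_, fun i hi => ?_⟩
      · rw [← h1 y]
        exact (traj_congr h y fun i hi => huu' i (by omega)).symm
      · change h (c i) (u' (m + i)) = _ ∧ h (c (i + 1)) (u' (m + i)) = _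
        rw [← huu' (m + i) (by omega)]
        exact h2 i hi) hpos
  filter_upwards [(measurePreserving_future ρ 0).quasiMeasurePreserving.ae hblock]
    with w ⟨s, hC, hB⟩ X hX
  have hXm : X (s + m) = c 1 := by
    rw [hc1, ← hX.walk_eq, ← hC (X s)]
    unfold walk
    congr 1
    funext k
    push_cast
    rw [zero_add]
  have hB' : ∀ i < M, h (c i) (w (s + m + i)) = c (i + 1) ∧
      h (c (i + 1)) (w (s + m + i)) = c (i + 2) := by
    intro i hi
    have := hB i hi
    push_cast at this
    rwa [zero_add, ← add_assoc] at this
  have hXi : ∀ i ≤ M, X (s + m + i) = c (i + 1) := by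
    intro i
    induction i with
    | zero => simpa using hXm
    | succ i ih =>
      intro hi
      have := isStatePath_graph_iff.1 hX (s + m + i)
      rw [ih (by omega), (hB' i (by omega)).2] at this
      push_cast
      rw [← add_assoc, ← this]
  -- The trailing line visits every state `x = c i` on its way to `c M`, whereas `X` is then at `c
  -- (M + 1) ≠ c M`.
  refine ⟨(s + m + M, c M), Set.mem_iInter.2 fun x => mem_bridgeVertices.2 ?_, ?_⟩
  · obtain ⟨i, hi, rfl⟩ := hcov x
    have hwalk : ∀ n, i + n ≤ M → walk h w (s + m + i) (c i) n = c (i + n) := by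
      intro n
      induction n with
      | zero => simp
      | succ n ih =>
        intro hn
        rw [walk_succ, ih (by omega)]
        have := (hB' (i + n) (by omega)).1
        push_cast at this
        rwa [← add_assoc] at this
    refine ⟨s + m + i, M - i, ?_⟩
    rw [follow_iterate, hwalk _ (by omega), Nat.add_sub_cancel' (by omega), Nat.cast_sub (by omega)]
    congr 1
    ring
  · simp only [hXi M le_rfl]
    exact (hc M (by omega)).1.symm

end FiniteStates

/-! ### Transfer of the hypotheses to the canonical i.i.d. sequence. -/

section Transfer

/-- A return at time `n` annihilates all terms with `k ≥ n`. Integrated, this bounds the sum of the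
tails by the mean return time. -/
lemma tsum_indicator_le_returnTime {S Ξ : Type*} (h : S → Ξ → S) (w : ℤ → Ξ) (x : S) :
    ∑' k : ℕ, Set.indicator {w | ∀ n < k, walk h w 0 x (n + 1) ≠ x} (1 : (ℤ → Ξ) → ℝ≥0∞) w ≤
      returnTime h w x := by
  refine le_iInf₂ fun n hn => ?_
  have hnx : walk h w 0 x n = x := by simpa [follow_iterate] using hn.2
  rw [tsum_eq_sum (s := Finset.range n)]
  · refine (Finset.sum_le_sum fun k _ => Set.indicator_le_self' (by simp) w).trans ?_
    simp
  · intro k hk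
    rw [Finset.mem_range, not_lt] at hk
    refine Set.indicator_of_notMem (s := {w | ∀ n < k, walk h w 0 x (n + 1) ≠ x})
      (fun hmem => hmem (n - 1) (Nat.sub_one_lt_of_le hn.1 hk) ?_) _
    rwa [Nat.sub_add_cancel hn.1]

variable {Ω S Ξ : Type*} [MeasurableSpace Ω] {μ : Measure Ω}
  [MeasurableSpace S] [MeasurableSpace Ξ] {h : S → Ξ → S} {ξ : ℤ → Ω → Ξ}

lemma FullyIndependent.measurePreserving (hind : FullyIndependent μ h ξ)
    (hξ : ∀ t, Measurable (ξ t)) :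
    MeasurePreserving (fun ω t => ξ t ω) μ (iid ℤ (μ.map (ξ 0))) := by
  refine ⟨measurable_pi_lambda _ hξ, ?_⟩
  rw [hind.indep.map_fun_eq_infinitePi_map hξ, iid]
  congr 1
  funext t
  exact (hind.identDistrib t).map_eq

lemma FullyIndependent.iIndepFun_map (hind : FullyIndependent μ h ξ)
    (hξ : ∀ t, Measurable (ξ t)) (hh : ∀ x, Measurable (h x)) :
    iIndepFun h (μ.map (ξ 0)) := by
  have h1 : iIndepFun (fun x ω => h x (ξ 0 ω)) μ :=
    (hind.vertical 0).comp (fun _ => Prod.snd) fun _ => measurable_snd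
  rw [iIndepFun_iff_measure_inter_preimage_eq_mul] at h1 ⊢
  intro A sets hsets
  rw [Measure.map_apply (hξ 0) (Finset.measurableSet_biInter A fun x hx => hh x (hsets x hx))]
  refine Eq.trans ?_ ((h1 A hsets).trans (Finset.prod_congr rfl fun x hx => ?_))
  · congr 1
    ext ω
    simp
  · rw [Measure.map_apply (hξ 0) (hh x (hsets x hx))]
    rfl

lemma transition_eq_transMatrix [DiscreteMeasurableSpace S] (hξ : Measurable (ξ 0))
    (hh : ∀ x, Measurable (h x)) : transition μ h ξ = transMatrix (μ.map (ξ 0)) h := by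
  funext x y
  exact (Measure.map_apply hξ (hh x (MeasurableSet.of_discrete (s := {y})))).symm

lemma PositiveRecurrent.tsum_occupation_ne_top [IsProbabilityMeasure μ] [Countable S]
    [DiscreteMeasurableSpace S] (hpos : PositiveRecurrent μ h ξ) (hind : FullyIndependent μ h ξ)
    (hξ : ∀ t, Measurable (ξ t)) (hh : ∀ x, Measurable (h x)) (x : S) :
    ∑' y, occupation (transMatrix (μ.map (ξ 0)) h) x y ≠ ∞ := by
  have := Measure.isProbabilityMeasure_map (μ := μ) (hξ 0).aemeasurable
  have hmp := hind.measurePreserving hξ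
  have hmeas : ∀ k, MeasurableSet {w : ℤ → Ξ | ∀ n < k, walk h w 0 x (n + 1) ≠ x} := by
    intro k
    simp only [Set.ofPred_forall]
    exact MeasurableSet.iInter fun n => MeasurableSet.iInter fun _ =>
      (measurable_walk hh 0 x (n + 1)) (MeasurableSet.of_discrete (s := {x}ᶜ))
  have hmeas' : ∀ k, MeasurableSet {u : ℕ → Ξ | ∀ n < k, traj h u x (n + 1) ≠ x} := by
    intro k
    simp only [Set.ofPred_forall]
    exact MeasurableSet.iInter fun n => MeasurableSet.iInter fun _ =>
      (measurable_traj hh x (n + 1)) (MeasurableSet.of_discrete (s := {x}ᶜ))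
  rw [tsum_occupation _ hh]
  refine ne_top_of_le_ne_top (hpos x).ne ?_
  calc ∑' k, iid ℕ (μ.map (ξ 0)) {u | ∀ n < k, traj h u x (n + 1) ≠ x}
      = ∑' k, ∫⁻ ω, Set.indicator {w | ∀ n < k, walk h w 0 x (n + 1) ≠ x}
          (1 : (ℤ → Ξ) → ℝ≥0∞) (fun t => ξ t ω) ∂μ := by
        refine tsum_congr fun k => ?_
        rw [hmp.lintegral_comp (measurable_one.indicator (hmeas k)),
          lintegral_indicator_one (hmeas k)]
        exact ((measurePreserving_future _ 0).measure_preimage (hmeas' k).nullMeasurableSet).symm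
    _ = ∫⁻ ω, ∑' k : ℕ, Set.indicator {w | ∀ n < k, walk h w 0 x (n + 1) ≠ x}
          (1 : (ℤ → Ξ) → ℝ≥0∞) (fun t => ξ t ω) ∂μ := by
        rw [lintegral_tsum]
        exact fun k => ((measurable_one.indicator (hmeas k)).comp hmp.measurable).aemeasurable
    _ ≤ ∫⁻ ω, returnTime h (fun t => ξ t ω) x ∂μ :=
        lintegral_mono fun ω => tsum_indicator_le_returnTime h _ x

end Transfer

end Doeblin

/-! ### The main theorem. -/

theorem mainTheorem8 {Ω S Ξ : Type*}
    [MeasurableSpace Ω] (μ : Measure Ω) [IsProbabilityMeasure μ]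
    [Countable S] [Nonempty S] [MeasurableSpace S] [DiscreteMeasurableSpace S]
    [MetricSpace Ξ] [CompleteSpace Ξ] [TopologicalSpace.SeparableSpace Ξ]
    [MeasurableSpace Ξ] [BorelSpace Ξ]
    (h : S → Ξ → S) (hh : ∀ x, Measurable (h x))
    (ξ : ℤ → Ω → Ξ) (hξ : ∀ t, Measurable (ξ t))
    (hind : Doeblin.FullyIndependent μ h ξ)
    (hirr : Doeblin.Irreducible (Doeblin.transition μ h ξ))
    (haper : Doeblin.Aperiodic (Doeblin.transition μ h ξ))
    (hpos : Doeblin.PositiveRecurrent μ h ξ) :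
    ∃ β : ℤ → Ω → S,
      (∀ t, Measurable (β t)) ∧
      -- `β` is a.s. the unique bi-recurrent state path in the Doeblin graph
      (∀ᵐ ω ∂μ,
        (Doeblin.IsStatePath (Doeblin.graph h (fun t => ξ t ω)) (fun t => β t ω) ∧
          Doeblin.BiRecurrent (fun t => β t ω)) ∧
        ∀ X : ℤ → S, Doeblin.IsStatePath (Doeblin.graph h (fun t => ξ t ω)) X →
          Doeblin.BiRecurrent X → X = fun t => β t ω) ∧
      -- infinite state space
      (Infinite S →
        (∀ᵐ ω ∂μ, Doeblin.LocallyFinite (Doeblin.graph h (fun t => ξ t ω))) →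
        (∀ᵐ ω ∂μ, ¬ ∃ X : ℤ → S,
          Doeblin.IsSpurious (Doeblin.graph h (fun t => ξ t ω)) X) →
        ∀ᵐ ω ∂μ, (⋂ x : S, Doeblin.bridgeVertices h (fun t => ξ t ω) x) =
          {v : ℤ × S | ∃ t : ℤ, v = (t, β t ω)}) ∧
      -- finite state space with at least two states
      (Finite S → Nontrivial S →
        ∀ᵐ ω ∂μ, {v : ℤ × S | ∃ t : ℤ, v = (t, β t ω)} ⊂
          ⋂ x : S, Doeblin.bridgeVertices h (fun t => ξ t ω) x) := by
  have := Measure.isProbabilityMeasure_map (μ := μ) (hξ 0).aemeasurable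
  have hmp := hind.measurePreserving hξ
  have hvert := hind.iIndepFun_map hξ hh
  have hfin := hpos.tsum_occupation_ne_top hind hξ hh
  rw [Doeblin.transition_eq_transMatrix (hξ 0) hh] at hirr haper
  have x : S := Classical.arbitrary S
  have hroot := hmp.quasiMeasurePreserving.ae
    (Doeblin.ae_root_spec (μ.map (ξ 0)) hh hvert hirr haper hfin x)
  refine ⟨fun t ω => Doeblin.root h x (fun s => ξ s ω) t,
    fun t => (Doeblin.measurable_root hh x t).comp hmp.measurable, ?_, ?_, ?_⟩
  · filter_upwards [hroot] with ω ⟨h1, h2, h3⟩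
    exact ⟨⟨h1, h2⟩, fun X hX hbi => h3 X hX ⟨x, hbi x⟩⟩
  · intro _ hloc hspur
    filter_upwards [hroot, hloc, hspur] with ω ⟨h1, h2, h3⟩ h4 h5
    exact Doeblin.iInter_bridgeVertices_eq h4 h5 h1 h2 h3
  · intro _ _
    filter_upwards [hroot, hmp.quasiMeasurePreserving.ae
      (Doeblin.ae_exists_mem_iInter_bridgeVertices (μ.map (ξ 0)) hh hvert hirr haper hfin)]
      with ω ⟨h1, h2, _⟩ h4
    obtain ⟨v, hv, hne⟩ := h4 _ h1
    refine (Set.ssubset_iff_of_subset (Doeblin.subset_iInter_bridgeVertices h1 h2)).2 ⟨v, hv, ?_⟩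
    rintro ⟨t, rfl⟩
    exact hne rfl
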